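/- **Setting.** Fix a finite family of free algebras $\mathbb A$ with pairwise disjoint finite sets of constructors $c_1^{\mathbb A},\dots,c_{k(\mathbb A)}^{\mathbb A}$ of arities $\mathcal R(c)\in\mathbb N$; write $\mathscr E_{\mathbb A}$ for the terms of $\mathbb A$. *Types:* $A::=\mathbb A^m\mid A\multimap A$ ($m\in\mathbb N$); $A\multimap^{n}B$ abbreviates $A\multimap\cdots\multimap A\multimap B$ ($n$ arguments). *Terms:* $M::=x\mid c\mid MM\mid\lambda x.M\mid M\{\!\{M_1,\dots,M_k\}\!\}\mid M\langle\!\langle M_1,\dots,M_k\rangle\!\rangle$ (conditional and recursion). *Values:* $x$, $\lambda x.M$, and the terms $T::=c\mid TT$. *Redexes:* $(\lambda x.M)V\to M\{V/x\}$ for a value $V$; and, for $t=c_i^{\mathbb A}t_1\cdots t_n\in\mathscr E_{\mathbb A}$ with $n=\mathcal R(c_i^{\mathbb A})$ and $k=k(\mathbb A)$, $\;t\{\!\{M_1,\dots,M_k\}\!\}\to M_it_1\cdots t_n$ and $t\langle\!\langle \vec M\rangle\!\rangle\to M_it_1\cdots t_n(t_1\langle\!\langle\vec M\rangle\!\rangle)\cdots(t_n\langle\!\langle\vec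 M\rangle\!\rangle)$. The argument of these redexes is $V$, $t$, $t$ respectively. $M\leadsto N$ means that $N$ results from firing one redex of $M$ that is neither under an abstraction nor inside a branch $M_i$ of a conditional or a recursion; $\leadsto^*$ is the reflexive and transitive closure. *System $\mathsf{H}(\mathsf A)$*, where $\mathsf A$ is the set of base types $\mathbb A^m$. Contexts that are joined have disjoint domains. Rules: axiom $x:A\vdash x:A$; weakening; contraction (from $\Gamma,x:A,y:A\vdash M:B$ infer $\Gamma,z:A\vdash M\{z/x,z/y\}:B$) only for $A\in\mathsf A$; $\multimap$-introduction; $\multimap$-elimination (from $\Gamma\vdash M:A\multimap B$ and $\Delta\vdash N:A$ infer $\Gamma,\Delta\vdash MN:B$); $\vdash c:\mathbb A^m\multimap^{\mathcal R(c)}\mathbb A^m$ for $c$ a constructor of $\mathbb A$; conditional: from $\Gamma_i\vdash M_i:\mathbb A^m\multimap^{\mathcal R(c_i)}C$ ($1\le i\le k(\mathbb A)$) and $\Delta\vdash L:\mathbb A^m$ infer $\Gamma_1,\dots,\Gamma_k,\Delta\vdash L\{\!\{\vec M\}\!\}:C$; recursion: from $\Gamma_i\vdash M_i:\mathbb A^m\multimap^{\mathcal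 R(c_i)}(C\multimap^{\mathcal R(c_i)}C)$, with all types in the $\Gamma_i$ in $\mathsf A$, and $\Delta\vdash L:\mathbb A^m$ infer $\Gamma_1,\dots,\Gamma_k,\Delta\vdash L\langle\!\langle\vec M\rangle\!\rangle:C$. **Interaction graphs.** The graph $G_\pi$ of a derivation $\pi:\Gamma\vdash M:A$ has one edge for each premise $x\in\Gamma$ and one for the conclusion, and every edge is labelled with a type. The axiom is a single edge that is both. Every other rule adds a vertex to the disjoint union of the graphs of its premises: weakening adds $W$ with a new incoming premise edge; contraction adds $X$ with a new incoming premise edge $h$ and the premise edges $e,g$ of $x,y$ as outgoing edges; $\multimap$-introduction adds $I_\multimap$ with the premise edge $e$ of $x$ (out), the conclusion edge $g$ of the body (in) and a new conclusion edge $h$ (out); $\multimap$-elimination adds $E_\multimap$ with the conclusion edges $e$ of the function and $g$ of the argument (in) and a new conclusion edge $h$; a constructor is a vertex $I^c_{\mathbb A}$ with an outgoing conclusion edge $e$; conditional and recursion add a vertex $C^N_{\mathbb A}$, resp. $C^R_{\mathbb A}$, with the conclusion edges $e_0$ of $L$ and $e_i$ of the $M_i$ (in) and a new conclusion edge $g$.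 For recursion, the graphs of all branches $M_i$ form the *box* of the new vertex $v$, and every premise edge $g$ of a branch gets a source vertex $P^R_{\mathbb A}$ with a new incoming premise edge $e$ outside the box. $\theta(e)$ is the $C^R$-vertex of the innermost box containing the edge $e$ (undefined if there is none), and $\rho(v)=e_0$ for a $C^R$-vertex $v$. **Context semantics.** A term context $u$ for $\mathbb A$ is a term of $\mathbb A$ with exactly one hole. A type context $L$ is a type with one hole; it is positive (negative) if the hole is to the left of an even (odd) number of arrows, and it is a focus for $A$ if $A=L[\mathbb A^m]$ for some base type $\mathbb A^m$. $P_A$ and $N_A$ range over positive and negative focuses for $A$. A stack is a finite sequence of triples $(u,s,v)$ with $u$ a term context and $s$ a term of one algebra and $v$ a vertex. $T(G)$ is a set of finite ordered trees with nodes labelled by tuples $(t,e,U,L)$ (algebra term, edge, stack, type context); $L(T)$ denotes the term in the root label of $T$. If $L(T)=u[s]$, then $B(T,u,s)$ is the smallest subtree of $T$ with term $s$ that is reached from the root guided by $u$. Write $l\leftarrow T_1,\dots,T_n$ for: the tree with root label $l$ and immediate subtrees $T_1,\dots,T_n$ is in $T(G)$ whenever $T_1,\dots,T_n\in T(G)$;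 a label on the right stands for any tree of $T(G)$ with that root label. $T(G)$ is the smallest set closed under the following conditions. The notation for incident edges is as above; $A,B$ are, where not said otherwise, the types that fit. * $I_\multimap$ ($e:A$, $g:B$): $(t,e,U,P_A)\leftarrow(t,h,U,P_A\multimap B)$; $(t,h,U,N_A\multimap B)\leftarrow(t,e,U,N_A)$; $(t,h,U,A\multimap P_B)\leftarrow(t,g,U,P_B)$; $(t,g,U,N_B)\leftarrow(t,h,U,A\multimap N_B)$. * $E_\multimap$ ($g:A$, $h:B$): $(t,e,U,P_A\multimap B)\leftarrow(t,g,U,P_A)$; $(t,g,U,N_A)\leftarrow(t,e,U,N_A\multimap B)$; $(t,e,U,A\multimap N_B)\leftarrow(t,h,U,N_B)$; $(t,h,U,P_B)\leftarrow(t,e,U,A\multimap P_B)$. * $X$: $(t,e,U,[\cdot])\leftarrow(t,h,U,[\cdot])$; $(t,g,U,[\cdot])\leftarrow(t,h,U,[\cdot])$. * $I^c_{\mathbb A}$ with $\mathcal R(c)=0$: if $\theta(e)$ is undefined, $(c,e,\varepsilon,[\cdot])\leftarrow$; if $\theta(e)=v$ and some tree of $T(G)$ has root label $(u[s],\rho(v),U,[\cdot])$,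 then $(c,e,(u,s,v)U,[\cdot])\leftarrow$. * $I^c_{\mathbb A}$ with $n=\mathcal R(c)\ge1$, at type $\mathbb A=\mathbb A^m$: $(ct_1\cdots t_n,e,U,\mathbb A\multimap^n[\cdot])\leftarrow T_1,\dots,T_n$, where $T_j$ has root label $(t_j,e,U,\mathbb A\multimap^{j-1}([\cdot]\multimap(\mathbb A\multimap^{n-j}\mathbb A)))$. * $C^N_{\mathbb A}$ ($g:A$), for every $T\in T(G)$ with root label $(c_it_1\cdots t_n,e_0,U,[\cdot])$: $(r,g,U,P_A)\leftarrow(r,e_i,U,\mathbb A\multimap^nP_A)$; $(r,e_i,U,\mathbb A\multimap^nN_A)\leftarrow(r,g,U,N_A)$; $(t_j,e_i,U,\mathbb A\multimap^{j-1}([\cdot]\multimap(\mathbb A\multimap^{n-j}A)))\leftarrow B(T,c_it_1\cdots t_{j-1}[\cdot]t_{j+1}\cdots t_n,t_j)$. * $C^R_{\mathbb A}$, a vertex $v$ ($g:A$), for every $T\in T(G)$ with root label $(u[s],e_0,U,[\cdot])$ where $s=c_it_1\cdots t_n$, and with $u_j=u[c_it_1\cdots t_{j-1}[\cdot]t_{j+1}\cdots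 t_n]$ for $1\le j\le n$: - $(t_j,e_i,(u,s,v)U,\mathbb A\multimap^{j-1}([\cdot]\multimap\mathbb A\multimap^{n-j}(A\multimap^nA)))\leftarrow B(T,u_j,t_j)$; - if $t_j=c_ls_1\cdots s_p$: $(r,e_i,(u,s,v)U,\mathbb A\multimap^n(A\multimap^{j-1}(P_A\multimap(A\multimap^{n-j}A))))\leftarrow(r,e_l,(u_j,t_j,v)U,\mathbb A\multimap^p(A\multimap^pP_A))$ and $(r,e_l,(u_j,t_j,v)U,\mathbb A\multimap^p(A\multimap^pN_A))\leftarrow(r,e_i,(u,s,v)U,\mathbb A\multimap^n(A\multimap^{j-1}(N_A\multimap(A\multimap^{n-j}A))))$; - if $u=[\cdot]$: $(r,g,U,P_A)\leftarrow(r,e_i,([\cdot],s,v)U,\mathbb A\multimap^n(A\multimap^nP_A))$ and $(r,e_i,([\cdot],s,v)U,\mathbb A\multimap^n(A\multimap^nN_A))\leftarrow(r,g,U,N_A)$. * $P^R_{\mathbb A}$, if $\theta(g)=v$ and some tree of $T(G)$ has root label $(u[s],\rho(v),U,[\cdot])$: $(t,g,(u,s,v)U,[\cdot])\leftarrow(t,e,U,[\cdot])$.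 **Theorem (Completeness).** Let $\pi:\Gamma\vdash M:A$ be a derivation in $\mathsf{H}(\mathsf A)$, let $M\leadsto^*N$, and let the free algebra term $t$ be the argument of a redex in $N$ that does not lie inside a branch $M_i$ of a recursion $L\langle\!\langle M_1,\dots,M_k\rangle\!\rangle$. Then there is a tree $T\in T(G_\pi)$ with $L(T)=t$. -/

import Mathlib

/-!
Gödel's System T over free algebras with weak call-by-value reduction, its linear type systems
`H(D)`, interaction graphs of type derivations, and their algebraic context semantics.
Free variables and bound variables are de Bruijn indices, so terms are taken up to renaming of
bound variables.  All positions (of arguments, of branches) are counted from `0`.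
-/

namespace ACS

/-- A finite family of free algebras.  The `a`-th algebra has the `k a` constructors
`0, …, k a - 1`, and `arity a c` is the arity of its constructor `c`.  A constructor is always
given together with its algebra, so the constructor sets are pairwise disjoint. -/
structure AlgFamily where
  n : ℕ
  k : Fin n → ℕ
  arity : (a : Fin n) → Fin (k a) → ℕ

variable {S : AlgFamily}

/-! ### Free algebra terms and term contexts -/

/-- The terms `c t₀ … t_{r-1}` of the algebra `a`. -/
inductive Alg (S : AlgFamily) (a : Fin S.n) : Type
  | mk (c : Fin (S.k a)) (ts : Fin (S.arity a c) → Alg S a) : Alg S a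

/-- The union of the sets of terms of all algebras of the family. -/
abbrev ETerm (S : AlgFamily) : Type := Σ a : Fin S.n, Alg S a

/-- Term contexts for the algebra `a`: terms with exactly one hole.  In `node c j u ts` the
argument number `j` of `c` is the context `u`, the others are given by `ts`. -/
inductive NCtx (S : AlgFamily) (a : Fin S.n) : Type
  | hole : NCtx S a
  | node (c : Fin (S.k a)) (j : Fin (S.arity a c)) (u : NCtx S a)
      (ts : {i : Fin (S.arity a c) // i ≠ j} → Alg S a) : NCtx S a

/-- `u[t]`. -/
def NCtx.fill {a : Fin S.n} : NCtx S a → Alg S a → Alg S a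
  | .hole, t => t
  | .node c j u ts, t => .mk c fun i => if h : i = j then u.fill t else ts ⟨i, h⟩

/-- `u[w]` for a context `w`. -/
def NCtx.comp {a : Fin S.n} : NCtx S a → NCtx S a → NCtx S a
  | .hole, w => w
  | .node c j u ts, w => .node c j (u.comp w) ts

/-- The context `c t₀ … t_{j-1} [·] t_{j+1} … t_{r-1}`. -/
def NCtx.around {a : Fin S.n} (c : Fin (S.k a)) (ts : Fin (S.arity a c) → Alg S a)
    (j : Fin (S.arity a c)) : NCtx S a :=
  .node c j .hole fun i => ts i.1

/-! ### Types and type contexts -/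

/-- Types: `base a m` is the base type `𝔸^m`, and `arr A B` is `A ⊸ B`. -/
inductive Ty (S : AlgFamily) : Type
  | base (a : Fin S.n) (m : ℕ) : Ty S
  | arr (A B : Ty S) : Ty S

/-- `A.arrows n B` is `A ⊸ (A ⊸ … (A ⊸ B))` with `n` arguments. -/
def Ty.arrows (A : Ty S) : ℕ → Ty S → Ty S
  | 0, B => B
  | n + 1, B => .arr A (A.arrows n B)

/-- The class of all base types. -/
def baseTypes (S : AlgFamily) : Set (Ty S) := {A | ∃ a m, A = .base a m}

/-- Type contexts: the hole, `L ⊸ A`, and `A ⊸ L`. -/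
inductive TyCtx (S : AlgFamily) : Type
  | hole : TyCtx S
  | left (L : TyCtx S) (A : Ty S) : TyCtx S
  | right (A : Ty S) (L : TyCtx S) : TyCtx S

/-- `L[B]`. -/
def TyCtx.fill : TyCtx S → Ty S → Ty S
  | .hole, B => B
  | .left L A, B => .arr (L.fill B) A
  | .right A L, B => .arr A (L.fill B)

/-- The polarity of a type context; `true` means positive. -/
def TyCtx.positive : TyCtx S → Bool
  | .hole => true
  | .left L _ => !L.positive
  | .right _ L => L.positive

/-- `L` is a positive focus for `A`. -/
def PosFocus (L : TyCtx S) (A : Ty S) : Prop :=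
  L.positive = true ∧ ∃ a m, A = L.fill (.base a m)

/-- `L` is a negative focus for `A`. -/
def NegFocus (L : TyCtx S) (A : Ty S) : Prop :=
  L.positive = false ∧ ∃ a m, A = L.fill (.base a m)

/-- `A ⊸ (A ⊸ … (A ⊸ L))` with `n` arguments. -/
def TyCtx.arrows (A : Ty S) : ℕ → TyCtx S → TyCtx S
  | 0, L => L
  | n + 1, L => .right A (TyCtx.arrows A n L)

/-- The type `A.arrows n B` with its argument number `j` replaced by the context `L`. -/
def TyCtx.argAt (A : Ty S) (n : ℕ) (j : Fin n) (L : TyCtx S) (B : Ty S) : TyCtx S :=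
  .arrows A j.1 (.left L (A.arrows (n - 1 - j.1) B))

/-! ### Terms -/

/-- Terms: variables, constructors, application, abstraction, conditional `M {{M₀, …}}` and
recursion `M ⟨⟨M₀, …⟩⟩`. -/
inductive Tm (S : AlgFamily) : Type
  | var (x : ℕ) : Tm S
  | con (a : Fin S.n) (c : Fin (S.k a)) : Tm S
  | app (M N : Tm S) : Tm S
  | lam (M : Tm S) : Tm S
  | cond (M : Tm S) {n : ℕ} (Ms : Fin n → Tm S) : Tm S
  | recur (M : Tm S) {n : ℕ} (Ms : Fin n → Tm S) : Tm S

/-- The action on indices of a renaming that goes under one binder. -/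
def liftRen (r : ℕ → ℕ) : ℕ → ℕ
  | 0 => 0
  | x + 1 => r x + 1

/-- Capture-avoiding renaming of free variables. -/
def Tm.rename : Tm S → (ℕ → ℕ) → Tm S
  | .var x, r => .var (r x)
  | .con a c, _ => .con a c
  | .app M N, r => .app (M.rename r) (N.rename r)
  | .lam M, r => .lam (M.rename (liftRen r))
  | .cond M Ms, r => .cond (M.rename r) fun i => (Ms i).rename r
  | .recur M Ms, r => .recur (M.rename r) fun i => (Ms i).rename r

/-- The action on indices of a substitution that goes under one binder. -/
def liftSub (s : ℕ → Tm S) : ℕ → Tm S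
  | 0 => .var 0
  | x + 1 => (s x).rename Nat.succ

/-- Capture-avoiding simultaneous substitution. -/
def Tm.subst : Tm S → (ℕ → Tm S) → Tm S
  | .var x, s => s x
  | .con a c, _ => .con a c
  | .app M N, s => .app (M.subst s) (N.subst s)
  | .lam M, s => .lam (M.subst (liftSub s))
  | .cond M Ms, s => .cond (M.subst s) fun i => (Ms i).subst s
  | .recur M Ms, s => .recur (M.subst s) fun i => (Ms i).subst s

/-- `M{V/x}` where `x` is the variable bound by the binder of which `M` is the body. -/
def Tm.inst (M V : Tm S) : Tm S :=
  M.subst fun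
    | 0 => V
    | x + 1 => .var x

/-- `M N₀ … N_{n-1}`. -/
def Tm.apps : Tm S → {n : ℕ} → (Fin n → Tm S) → Tm S
  | M, 0, _ => M
  | M, _ + 1, Ns => (M.app (Ns 0)).apps (Fin.tail Ns)

/-- A free algebra term, seen as a term of the calculus. -/
def Alg.toTm {a : Fin S.n} : Alg S a → Tm S
  | .mk c ts => (Tm.con a c).apps fun i => (ts i).toTm

/-- The terms `T ::= c | T T`. -/
inductive IsAlgebraic : Tm S → Prop
  | con (a : Fin S.n) (c : Fin (S.k a)) : IsAlgebraic (.con a c)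
  | app {M N : Tm S} : IsAlgebraic M → IsAlgebraic N → IsAlgebraic (.app M N)

/-- The values `V ::= x | λx.M | T`. -/
inductive IsValue : Tm S → Prop
  | var (x : ℕ) : IsValue (.var x)
  | lam (M : Tm S) : IsValue (.lam M)
  | alg {M : Tm S} : IsAlgebraic M → IsValue M

/-- The reduction rules: firing a beta, a conditional or a recursive redex. -/
inductive Red : Tm S → Tm S → Prop
  | beta {M V : Tm S} : IsValue V → Red (.app (.lam M) V) (M.inst V)
  | cond {a : Fin S.n} {c : Fin (S.k a)} {ts : Fin (S.arity a c) → Alg S a}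
      {Ms : Fin (S.k a) → Tm S} :
      Red (.cond (Alg.mk c ts).toTm Ms) ((Ms c).apps fun j => (ts j).toTm)
  | recur {a : Fin S.n} {c : Fin (S.k a)} {ts : Fin (S.arity a c) → Alg S a}
      {Ms : Fin (S.k a) → Tm S} :
      Red (.recur (Alg.mk c ts).toTm Ms)
        (((Ms c).apps fun j => (ts j).toTm).apps fun j => .recur (ts j).toTm Ms)

/-- Weak reduction `M ⇝ N`: no redex is fired under an abstraction or in a branch of a conditional
or of a recursion. -/
inductive Step : Tm S → Tm S → Prop
  | red {M N : Tm S} : Red M N → Step M N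
  | appL {M N L : Tm S} : Step M N → Step (.app M L) (.app N L)
  | appR {M N L : Tm S} : Step M N → Step (.app L M) (.app L N)
  | cond {M N : Tm S} {n : ℕ} {Ls : Fin n → Tm S} : Step M N → Step (.cond M Ls) (.cond N Ls)
  | recur {M N : Tm S} {n : ℕ} {Ls : Fin n → Tm S} : Step M N → Step (.recur M Ls) (.recur N Ls)

/-- `M ⇝* N`. -/
def Steps : Tm S → Tm S → Prop := Relation.ReflTransGen Step

/-- `RedexArg N t`: the free algebra term `t` is the argument of a redex that occurs in `N` at
a position that is not inside a branch of a recursion (it may be under an abstraction or in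
a branch of a conditional). -/
inductive RedexArg {a : Fin S.n} : Tm S → Alg S a → Prop
  | beta (M : Tm S) (t : Alg S a) : RedexArg (.app (.lam M) t.toTm) t
  | condRedex (t : Alg S a) (Ms : Fin (S.k a) → Tm S) : RedexArg (.cond t.toTm Ms) t
  | recRedex (t : Alg S a) (Ms : Fin (S.k a) → Tm S) : RedexArg (.recur t.toTm Ms) t
  | appL {M N : Tm S} {t : Alg S a} : RedexArg M t → RedexArg (.app M N) t
  | appR {M N : Tm S} {t : Alg S a} : RedexArg N t → RedexArg (.app M N) t
  | lam {M : Tm S} {t : Alg S a} : RedexArg M t → RedexArg (.lam M) t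
  | cond {M : Tm S} {n : ℕ} {Ms : Fin n → Tm S} {t : Alg S a} :
      RedexArg M t → RedexArg (.cond M Ms) t
  | condBranch {M : Tm S} {n : ℕ} {Ms : Fin n → Tm S} {t : Alg S a} (i : Fin n) :
      RedexArg (Ms i) t → RedexArg (.cond M Ms) t
  | recur {M : Tm S} {n : ℕ} {Ms : Fin n → Tm S} {t : Alg S a} :
      RedexArg M t → RedexArg (.recur M Ms) t

/-! ### Type derivations -/

/-- Typing contexts: partial maps from variables to types.  (Those of derivations are finite.) -/
abbrev Ctx (S : AlgFamily) : Type := ℕ → Option (Ty S)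

/-- The empty context. -/
def Ctx.empty : Ctx S := fun _ => none

/-- `Γ, x : A`. -/
def Ctx.add (Γ : Ctx S) (x : ℕ) (A : Ty S) : Ctx S :=
  fun y => if y = x then some A else Γ y

/-- The context of the body of an abstraction whose context is `Γ`, with `A` the type of the bound
variable. -/
def Ctx.bind (Γ : Ctx S) (A : Ty S) : Ctx S
  | 0 => some A
  | x + 1 => Γ x

/-- `Θ` is the union of the contexts `Γs i`, the domains of which are pairwise disjoint. -/
structure IsJoin {ι : Type} (Γs : ι → Ctx S) (Θ : Ctx S) : Prop where
  mem_iff : ∀ x A, Θ x = some A ↔ ∃ i, Γs i x = some A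
  disjoint : ∀ x i j, (Γs i x).isSome → (Γs j x).isSome → i = j

theorem IsJoin.exists {ι : Type} {Γs : ι → Ctx S} {Θ : Ctx S} (h : IsJoin Γs Θ) (x : ℕ)
    (hx : (Θ x).isSome) : ∃ i, (Γs i x).isSome := by
  obtain ⟨A, hA⟩ := Option.isSome_iff_exists.1 hx
  obtain ⟨i, hi⟩ := (h.mem_iff x A).1 hA
  exact ⟨i, by simp [hi]⟩

/-- The pair of contexts `Γ`, `Δ`. -/
def Ctx.pair (Γ Δ : Ctx S) : Bool → Ctx S
  | false => Γ
  | true => Δ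

/-- The family of contexts `Γ₀, …, Γ_{k-1}, Δ`. -/
def Ctx.family {k : ℕ} (Γs : Fin k → Ctx S) (Δ : Ctx S) : Option (Fin k) → Ctx S
  | some i => Γs i
  | none => Δ

/-- The renaming `{z/x, z/y}`. -/
def mergeRen (x y z : ℕ) : ℕ → ℕ := fun w => if w = x ∨ w = y then z else w

/-- Type derivations of the system `H(D)`: contraction is restricted to types in `D`, and so are
the types in the contexts of the branches of a recursion. -/
inductive Deriv (D : Set (Ty S)) : Ctx S → Tm S → Ty S → Type
  | ax (x : ℕ) (A : Ty S) : Deriv D (Ctx.empty.add x A) (.var x) A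
  | weak {Γ : Ctx S} {M : Tm S} {B : Ty S} (x : ℕ) (A : Ty S) (hx : Γ x = none)
      (π : Deriv D Γ M B) : Deriv D (Γ.add x A) M B
  | contr {Γ : Ctx S} {M N : Tm S} {B : Ty S} (x y z : ℕ) (A : Ty S) (hA : A ∈ D) (hxy : x ≠ y)
      (hx : Γ x = none) (hy : Γ y = none) (hz : Γ z = none) (hN : N = M.rename (mergeRen x y z))
      (π : Deriv D ((Γ.add x A).add y A) M B) : Deriv D (Γ.add z A) N B
  | lam {Γ : Ctx S} {M : Tm S} {A B : Ty S} (π : Deriv D (Γ.bind A) M B) :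
      Deriv D Γ (.lam M) (.arr A B)
  | app {Γ Δ Θ : Ctx S} {M N : Tm S} {A B : Ty S} (h : IsJoin (Ctx.pair Γ Δ) Θ)
      (π : Deriv D Γ M (.arr A B)) (ξ : Deriv D Δ N A) : Deriv D Θ (.app M N) B
  | con {B : Ty S} (a : Fin S.n) (c : Fin (S.k a)) (m : ℕ)
      (hB : B = (Ty.base a m).arrows (S.arity a c) (.base a m)) :
      Deriv D Ctx.empty (.con a c) B
  | cond {a : Fin S.n} {m : ℕ} {Γs : Fin (S.k a) → Ctx S} {Δ Θ : Ctx S} {L : Tm S}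
      {Ms : Fin (S.k a) → Tm S} {C : Ty S} (h : IsJoin (Ctx.family Γs Δ) Θ)
      (πs : ∀ i, Deriv D (Γs i) (Ms i) ((Ty.base a m).arrows (S.arity a i) C))
      (ξ : Deriv D Δ L (.base a m)) : Deriv D Θ (.cond L Ms) C
  | recur {a : Fin S.n} {m : ℕ} {Γs : Fin (S.k a) → Ctx S} {Δ Θ : Ctx S} {L : Tm S}
      {Ms : Fin (S.k a) → Tm S} {C : Ty S} (h : IsJoin (Ctx.family Γs Δ) Θ)
      (hD : ∀ i x A, Γs i x = some A → A ∈ D)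
      (πs : ∀ i, Deriv D (Γs i) (Ms i)
        ((Ty.base a m).arrows (S.arity a i) (C.arrows (S.arity a i) C)))
      (ξ : Deriv D Δ L (.base a m)) : Deriv D Θ (.recur L Ms) C

/-! ### Interaction graphs -/

/-- The label of a vertex together with the edges incident to it.
* `weak h`: label `W`, incoming edge `h`.
* `contr h e g`: label `X`, incoming edge `h`, outgoing edges `e` and `g`.
* `lam e g h`: label `I_⊸`, with `e` the outgoing edge to the occurrence of the bound variable, `g`
  the incoming edge from the body, `h` the outgoing edge of the abstraction.
* `app e g h`: label `E_⊸`, with `e` the incoming edge from the function, `g` the incoming edge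
  from the argument, `h` the outgoing edge of the application.
* `con a c m e`: label `I^c_𝔸` at the base type `𝔸^m`, outgoing edge `e`.
* `cond a e₀ es g`: label `C^N_𝔸`, with `e₀` the incoming edge from the scrutinee, `es i` the
  incoming edge from the branch of the constructor `i`, `g` the outgoing edge.
* `recC a e₀ es g`: label `C^R_𝔸`, with the same edges; the `es i` come from inside the box.
* `recP e g`: label `P^R_𝔸`, with `e` the incoming edge from outside the box, `g` the outgoing edge
  into the box. -/
inductive Link (S : AlgFamily) (E : Type) : Type
  | weak (h : E) : Link S E
  | contr (h e g : E) : Link S E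
  | lam (e g h : E) : Link S E
  | app (e g h : E) : Link S E
  | con (a : Fin S.n) (c : Fin (S.k a)) (m : ℕ) (e : E) : Link S E
  | cond (a : Fin S.n) (e₀ : E) (es : Fin (S.k a) → E) (g : E) : Link S E
  | recC (a : Fin S.n) (e₀ : E) (es : Fin (S.k a) → E) (g : E) : Link S E
  | recP (e g : E) : Link S E

/-- Renaming the edges. -/
def Link.map {E E' : Type} (f : E → E') : Link S E → Link S E'
  | .weak h => .weak (f h)
  | .contr h e g => .contr (f h) (f e) (f g)
  | .lam e g h => .lam (f e) (f g) (f h)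
  | .app e g h => .app (f e) (f g) (f h)
  | .con a c m e => .con a c m (f e)
  | .cond a e₀ es g => .cond a (f e₀) (fun i => f (es i)) (f g)
  | .recC a e₀ es g => .recC a (f e₀) (fun i => f (es i)) (f g)
  | .recP e g => .recP (f e) (f g)

/-- Interaction graphs with premises `Γ`.  The vertices labelled `P` and `C` that only mark the
premises and the conclusion are represented by the edges incident to them: `prem x _` is the edge
that comes from the premise `x`, and `concl` is the edge that goes to the conclusion. -/
structure IGraph (S : AlgFamily) (Γ : Ctx S) where
  /-- Vertices. -/
  V : Type
  /-- Edges. -/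
  E : Type
  /-- Label of a vertex and edges incident to it. -/
  link : V → Link S E
  /-- Type of an edge. -/
  ty : E → Ty S
  /-- The box-premise of an edge: the vertex labelled `C^R_𝔸` of the innermost box that contains
  the edge; `none` if there is no such box. -/
  box : E → Option V
  /-- The conclusion. -/
  concl : E
  /-- The premises. -/
  prem : ∀ x, (Γ x).isSome → E

/-- The recursive premise of a vertex labelled `C^R_𝔸`. -/
def IGraph.rho {Γ : Ctx S} (G : IGraph S Γ) (v : G.V) : Option G.E :=
  match G.link v with
  | .recC _ e₀ _ _ => some e₀
  | _ => none

theorem Ctx.isSome_of_add {Γ : Ctx S} {x y : ℕ} {A : Ty S} (hy : (Γ.add x A y).isSome)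
    (h : y ≠ x) : (Γ y).isSome := by
  simpa [Ctx.add, h] using hy

theorem Ctx.isSome_add_self (Γ : Ctx S) (x : ℕ) (A : Ty S) : (Γ.add x A x).isSome := by
  simp [Ctx.add]

theorem Ctx.isSome_add {Γ : Ctx S} {y : ℕ} (x : ℕ) (A : Ty S) (hy : (Γ y).isSome) :
    (Γ.add x A y).isSome := by
  unfold Ctx.add
  split <;> simp [hy]

/-- The premise edges of a graph that is composed of graphs with disjoint sets of premises. -/
noncomputable def joinPrem {ι E : Type} {Γs : ι → Ctx S} {Θ : Ctx S} (h : IsJoin Γs Θ)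
    (p : ∀ i x, (Γs i x).isSome → E) (x : ℕ) (hx : (Θ x).isSome) : E :=
  p (h.exists x hx).choose x (h.exists x hx).choose_spec

namespace IGraph

/-- A single edge from the premise `x` to the conclusion. -/
def axG (x : ℕ) (A : Ty S) : IGraph S (Ctx.empty.add x A) where
  V := Empty
  E := Unit
  link := Empty.elim
  ty := fun _ => A
  box := fun _ => none
  concl := ()
  prem := fun _ _ => ()

/-- A vertex labelled `I^c_𝔸` with an edge to the conclusion. -/
def conG (a : Fin S.n) (c : Fin (S.k a)) (m : ℕ) : IGraph S Ctx.empty where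
  V := Unit
  E := Unit
  link := fun _ => .con a c m ()
  ty := fun _ => (Ty.base a m).arrows (S.arity a c) (.base a m)
  box := fun _ => none
  concl := ()
  prem := fun _ _ => ()

/-- A new premise `x` with an edge (`none`) to a new vertex (`none`) labelled `W`. -/
def weakG {Γ : Ctx S} (x : ℕ) (A : Ty S) (G : IGraph S Γ) : IGraph S (Γ.add x A) where
  V := Option G.V
  E := Option G.E
  link
    | none => .weak none
    | some v => (G.link v).map some
  ty
    | none => A
    | some e => G.ty e
  box
    | none => none
    | some e => (G.box e).map some
  concl := some G.concl
  prem := fun y hy => if h : y = x then none else some (G.prem y (Ctx.isSome_of_add hy h))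

/-- The premises `x` and `y` are merged by a new vertex (`none`) labelled `X`, with an edge (`none`)
coming from the new premise `z`. -/
def contrG {Γ : Ctx S} (x y z : ℕ) (A : Ty S) (G : IGraph S ((Γ.add x A).add y A)) :
    IGraph S (Γ.add z A) where
  V := Option G.V
  E := Option G.E
  link
    | none => .contr none
        (some (G.prem x (Ctx.isSome_add y A (Ctx.isSome_add_self Γ x A))))
        (some (G.prem y (Ctx.isSome_add_self (Γ.add x A) y A)))
    | some v => (G.link v).map some
  ty
    | none => A
    | some e => G.ty e
  box
    | none => none
    | some e => (G.box e).map some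
  concl := some G.concl
  prem := fun w hw =>
    if h : w = z then none
    else some (G.prem w (Ctx.isSome_add y A (Ctx.isSome_add x A (Ctx.isSome_of_add hw h))))

/-- A new vertex (`none`) labelled `I_⊸` with an edge (`none`) to the conclusion. -/
def lamG {Γ : Ctx S} (A B : Ty S) (G : IGraph S (Γ.bind A)) : IGraph S Γ where
  V := Option G.V
  E := Option G.E
  link
    | none => .lam (some (G.prem 0 rfl)) (some G.concl) none
    | some v => (G.link v).map some
  ty
    | none => .arr A B
    | some e => G.ty e
  box
    | none => none
    | some e => (G.box e).map some
  concl := none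
  prem := fun x hx => some (G.prem (x + 1) hx)

/-- A new vertex (`none`) labelled `E_⊸` with an edge (`none`) to the conclusion. -/
noncomputable def appG {Γ Δ Θ : Ctx S} (h : IsJoin (Ctx.pair Γ Δ) Θ) (B : Ty S)
    (G : IGraph S Γ) (H : IGraph S Δ) : IGraph S Θ where
  V := Option (G.V ⊕ H.V)
  E := Option (G.E ⊕ H.E)
  link
    | none => .app (some (.inl G.concl)) (some (.inr H.concl)) none
    | some (.inl v) => (G.link v).map fun e => some (.inl e)
    | some (.inr v) => (H.link v).map fun e => some (.inr e)
  ty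
    | none => B
    | some (.inl e) => G.ty e
    | some (.inr e) => H.ty e
  box
    | none => none
    | some (.inl e) => (G.box e).map fun v => some (.inl v)
    | some (.inr e) => (H.box e).map fun v => some (.inr v)
  concl := none
  prem := joinPrem h fun
    | false, x, hx => some (.inl (G.prem x hx))
    | true, x, hx => some (.inr (H.prem x hx))

/-- A new vertex (`none`) labelled `C^N_𝔸` with an edge (`none`) to the conclusion. -/
noncomputable def condG {a : Fin S.n} {Γs : Fin (S.k a) → Ctx S} {Δ Θ : Ctx S}
    (h : IsJoin (Ctx.family Γs Δ) Θ) (C : Ty S) (Gs : ∀ i, IGraph S (Γs i)) (H : IGraph S Δ) :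
    IGraph S Θ where
  V := Option (H.V ⊕ Σ i, (Gs i).V)
  E := Option (H.E ⊕ Σ i, (Gs i).E)
  link
    | none => .cond a (some (.inl H.concl)) (fun i => some (.inr ⟨i, (Gs i).concl⟩)) none
    | some (.inl v) => (H.link v).map fun e => some (.inl e)
    | some (.inr ⟨i, v⟩) => ((Gs i).link v).map fun e => some (.inr ⟨i, e⟩)
  ty
    | none => C
    | some (.inl e) => H.ty e
    | some (.inr ⟨i, e⟩) => (Gs i).ty e
  box
    | none => none
    | some (.inl e) => (H.box e).map fun v => some (.inl v)
    | some (.inr ⟨i, e⟩) => ((Gs i).box e).map fun v => some (.inr ⟨i, v⟩)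
  concl := none
  prem := joinPrem h fun
    | none, x, hx => some (.inl (H.prem x hx))
    | some i, x, hx => some (.inr ⟨i, (Gs i).prem x hx⟩)

/-- The pairs of a branch and a premise of it. -/
abbrev BoxPrem {k : ℕ} (Γs : Fin k → Ctx S) : Type := Σ i, {x : ℕ // (Γs i x).isSome}

/-- A new vertex (`none`) labelled `C^R_𝔸` with an edge (`none`) to the conclusion; the graphs of the
branches form its box.  For every premise `q` of a branch there is a new vertex `q` labelled
`P^R_𝔸` with a new edge `q` that comes from outside the box. -/
noncomputable def recG {a : Fin S.n} {Γs : Fin (S.k a) → Ctx S} {Δ Θ : Ctx S}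
    (h : IsJoin (Ctx.family Γs Δ) Θ) (C : Ty S) (Gs : ∀ i, IGraph S (Γs i)) (H : IGraph S Δ) :
    IGraph S Θ where
  V := Option (H.V ⊕ (Σ i, (Gs i).V) ⊕ BoxPrem Γs)
  E := Option (H.E ⊕ (Σ i, (Gs i).E) ⊕ BoxPrem Γs)
  link
    | none =>
        .recC a (some (.inl H.concl)) (fun i => some (.inr (.inl ⟨i, (Gs i).concl⟩))) none
    | some (.inl v) => (H.link v).map fun e => some (.inl e)
    | some (.inr (.inl ⟨i, v⟩)) => ((Gs i).link v).map fun e => some (.inr (.inl ⟨i, e⟩))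
    | some (.inr (.inr ⟨i, x⟩)) =>
        .recP (some (.inr (.inr ⟨i, x⟩))) (some (.inr (.inl ⟨i, (Gs i).prem x.1 x.2⟩)))
  ty
    | none => C
    | some (.inl e) => H.ty e
    | some (.inr (.inl ⟨i, e⟩)) => (Gs i).ty e
    | some (.inr (.inr ⟨i, x⟩)) => (Γs i x.1).get x.2
  box
    | none => none
    | some (.inl e) => (H.box e).map fun v => some (.inl v)
    | some (.inr (.inl ⟨i, e⟩)) =>
        match (Gs i).box e with
        | none => some none
        | some v => some (some (.inr (.inl ⟨i, v⟩)))
    | some (.inr (.inr _)) => none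
  concl := none
  prem := joinPrem h fun
    | none, x, hx => some (.inl (H.prem x hx))
    | some i, x, hx => some (.inr (.inr ⟨i, ⟨x, hx⟩⟩))

end IGraph

/-- The interaction graph `G_π` of a type derivation `π`. -/
noncomputable def Deriv.graph {D : Set (Ty S)} :
    {Γ : Ctx S} → {M : Tm S} → {A : Ty S} → Deriv D Γ M A → IGraph S Γ
  | _, _, _, .ax x A => .axG x A
  | _, _, _, .weak x A _ π => .weakG x A π.graph
  | _, _, _, .contr x y z A _ _ _ _ _ _ π => .contrG x y z A π.graph
  | _, _, _, .lam (A := A) (B := B) π => .lamG A B π.graph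
  | _, _, _, .app (B := B) h π ξ => .appG h B π.graph ξ.graph
  | _, _, _, .con a c m _ => .conG a c m
  | _, _, _, .cond (C := C) h πs ξ => .condG h C (fun i => (πs i).graph) ξ.graph
  | _, _, _, .recur (C := C) h _ πs ξ => .recG h C (fun i => (πs i).graph) ξ.graph

/-! ### Algebraic context semantics -/

/-- The entries `(u, s, v)` of a stack; `u` and `s` belong to the same algebra. -/
structure Entry (S : AlgFamily) (V : Type) where
  alg : Fin S.n
  u : NCtx S alg
  s : Alg S alg
  v : V

/-- The labels `(t, e, U, L)` of the nodes of trees.  The leftmost entry of a stack is the head of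
the list. -/
structure Label {Γ : Ctx S} (G : IGraph S Γ) where
  term : ETerm S
  edge : G.E
  stack : List (Entry S G.V)
  focus : TyCtx S

/-- Finite ordered trees `(l, f)` the nodes of which have labels. -/
inductive Tree {Γ : Ctx S} (G : IGraph S Γ) : Type
  | node (l : Label G) (k : ℕ) (f : Fin k → Tree G) : Tree G

namespace Tree

variable {Γ : Ctx S} {G : IGraph S Γ}

/-- The label of the root. -/
def label : Tree G → Label G
  | .node l _ _ => l

/-- `L(T)`: the first component of the label of the root. -/
def term (T : Tree G) : ETerm S := T.label.term

/-- The tree that consists of a root only. -/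
def leaf (l : Label G) : Tree G := .node l 0 Fin.elim0

/-- The tree with root `l` and one immediate subtree. -/
def cons (l : Label G) (T : Tree G) : Tree G := .node l 1 fun _ => T

open Classical in
/-- Walk from the root towards the leaves as long as the term does not change, that is, down to the
node where the head constructor of the term was introduced. -/
noncomputable def skip : Tree G → Tree G
  | .node l k f =>
      if h : k = 1 ∧ ∀ i, (f i).term = l.term then (f ⟨0, by omega⟩).skip else .node l k f

/-- The immediate subtree number `j`, if there is one. -/
def child : Tree G → ℕ → Option (Tree G)
  | .node _ k f, j => if h : j < k then some (f ⟨j, h⟩) else none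

/-- `T.sub u` is the smallest subtree of `T` that corresponds to the subterm `s` if the term of `T` is
`u[s]`: walk from the root towards the leaves, guided by `u`, as far as possible. -/
noncomputable def sub {a : Fin S.n} : NCtx S a → Tree G → Tree G
  | .hole, T => T.skip
  | .node _ j u _, T =>
      match T.skip.child j.1 with
      | some T' => sub u T'
      | none => T

end Tree

/-- The set `T(G)` of trees of an interaction graph `G`: the smallest set that satisfies the closure
conditions induced by the vertices of `G`. -/
inductive InT {Γ : Ctx S} (G : IGraph S Γ) : Tree G → Prop
  -- vertices labelled `I_⊸`
  | lam_arg_pos {v e g h t U P T} : G.link v = .lam e g h → PosFocus P (G.ty e) →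
      InT G T → T.label = ⟨t, h, U, .left P (G.ty g)⟩ → InT G (.cons ⟨t, e, U, P⟩ T)
  | lam_arg_neg {v e g h t U N T} : G.link v = .lam e g h → NegFocus N (G.ty e) →
      InT G T → T.label = ⟨t, e, U, N⟩ → InT G (.cons ⟨t, h, U, .left N (G.ty g)⟩ T)
  | lam_res_pos {v e g h t U P T} : G.link v = .lam e g h → PosFocus P (G.ty g) →
      InT G T → T.label = ⟨t, g, U, P⟩ → InT G (.cons ⟨t, h, U, .right (G.ty e) P⟩ T)
  | lam_res_neg {v e g h t U N T} : G.link v = .lam e g h → NegFocus N (G.ty g) →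
      InT G T → T.label = ⟨t, h, U, .right (G.ty e) N⟩ → InT G (.cons ⟨t, g, U, N⟩ T)
  -- vertices labelled `E_⊸`
  | app_arg_pos {v e g h t U P T} : G.link v = .app e g h → PosFocus P (G.ty g) →
      InT G T → T.label = ⟨t, g, U, P⟩ → InT G (.cons ⟨t, e, U, .left P (G.ty h)⟩ T)
  | app_arg_neg {v e g h t U N T} : G.link v = .app e g h → NegFocus N (G.ty g) →
      InT G T → T.label = ⟨t, e, U, .left N (G.ty h)⟩ → InT G (.cons ⟨t, g, U, N⟩ T)
  | app_res_neg {v e g h t U N T} : G.link v = .app e g h → NegFocus N (G.ty h) →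
      InT G T → T.label = ⟨t, h, U, N⟩ → InT G (.cons ⟨t, e, U, .right (G.ty g) N⟩ T)
  | app_res_pos {v e g h t U P T} : G.link v = .app e g h → PosFocus P (G.ty h) →
      InT G T → T.label = ⟨t, e, U, .right (G.ty g) P⟩ → InT G (.cons ⟨t, h, U, P⟩ T)
  -- vertices labelled `X`
  | contr_left {v h e g t U T} : G.link v = .contr h e g →
      InT G T → T.label = ⟨t, h, U, .hole⟩ → InT G (.cons ⟨t, e, U, .hole⟩ T)
  | contr_right {v h e g t U T} : G.link v = .contr h e g →
      InT G T → T.label = ⟨t, h, U, .hole⟩ → InT G (.cons ⟨t, g, U, .hole⟩ T)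
  -- vertices labelled `I^c_𝔸` where `c` has arity `0`, inside a box and outside all boxes
  | con_zero_box {v a c m e ts w e₀ b u s U T} : G.link v = .con a c m e → S.arity a c = 0 →
      G.box e = some w → G.rho w = some e₀ →
      InT G T → T.label = ⟨⟨b, NCtx.fill u s⟩, e₀, U, .hole⟩ →
      InT G (.leaf ⟨⟨a, .mk c ts⟩, e, ⟨b, u, s, w⟩ :: U, .hole⟩)
  | con_zero {v a c m e ts} : G.link v = .con a c m e → S.arity a c = 0 → G.box e = none →
      InT G (.leaf ⟨⟨a, .mk c ts⟩, e, [], .hole⟩)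
  -- vertices labelled `I^c_𝔸` where `c` has positive arity
  | con_succ {v a c m e ts U} {Ts : Fin (S.arity a c) → Tree G} : G.link v = .con a c m e →
      0 < S.arity a c → (∀ j, InT G (Ts j)) →
      (∀ j, (Ts j).label =
        ⟨⟨a, ts j⟩, e, U, .argAt (.base a m) (S.arity a c) j .hole (.base a m)⟩) →
      InT G (.node ⟨⟨a, .mk c ts⟩, e, U, .arrows (.base a m) (S.arity a c) .hole⟩
        (S.arity a c) Ts)
  -- vertices labelled `C^N_𝔸`
  | cond_res_pos {v a e₀ es g i ts U T r P T'} : G.link v = .cond a e₀ es g →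
      InT G T → T.label = ⟨⟨a, .mk i ts⟩, e₀, U, .hole⟩ → PosFocus P (G.ty g) →
      InT G T' → T'.label = ⟨r, es i, U, .arrows (G.ty e₀) (S.arity a i) P⟩ →
      InT G (.cons ⟨r, g, U, P⟩ T')
  | cond_res_neg {v a e₀ es g i ts U T r N T'} : G.link v = .cond a e₀ es g →
      InT G T → T.label = ⟨⟨a, .mk i ts⟩, e₀, U, .hole⟩ → NegFocus N (G.ty g) →
      InT G T' → T'.label = ⟨r, g, U, N⟩ →
      InT G (.cons ⟨r, es i, U, .arrows (G.ty e₀) (S.arity a i) N⟩ T')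
  | cond_arg {v a e₀ es g i ts U T} (j : Fin (S.arity a i)) : G.link v = .cond a e₀ es g →
      InT G T → T.label = ⟨⟨a, .mk i ts⟩, e₀, U, .hole⟩ →
      InT G (.cons ⟨⟨a, ts j⟩, es i, U, .argAt (G.ty e₀) (S.arity a i) j .hole (G.ty g)⟩
        (T.sub (NCtx.around i ts j)))
  -- vertices labelled `C^R_𝔸`: from one copy of the box to another one
  | rec_copy_pos {v a e₀ es g u i ts j ss U T r P T'} (k : Fin (S.arity a i)) :
      G.link v = .recC a e₀ es g →
      InT G T → T.label = ⟨⟨a, NCtx.fill u (.mk i ts)⟩, e₀, U, .hole⟩ → ts k = .mk j ss →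
      PosFocus P (G.ty g) →
      InT G T' → T'.label = ⟨r, es j, ⟨a, u.comp (NCtx.around i ts k), ts k, v⟩ :: U,
        .arrows (G.ty e₀) (S.arity a j) (.arrows (G.ty g) (S.arity a j) P)⟩ →
      InT G (.cons ⟨r, es i, ⟨a, u, .mk i ts, v⟩ :: U,
        .arrows (G.ty e₀) (S.arity a i) (.argAt (G.ty g) (S.arity a i) k P (G.ty g))⟩ T')
  | rec_copy_neg {v a e₀ es g u i ts j ss U T r N T'} (k : Fin (S.arity a i)) :
      G.link v = .recC a e₀ es g →
      InT G T → T.label = ⟨⟨a, NCtx.fill u (.mk i ts)⟩, e₀, U, .hole⟩ → ts k = .mk j ss →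
      NegFocus N (G.ty g) →
      InT G T' → T'.label = ⟨r, es i, ⟨a, u, .mk i ts, v⟩ :: U,
        .arrows (G.ty e₀) (S.arity a i) (.argAt (G.ty g) (S.arity a i) k N (G.ty g))⟩ →
      InT G (.cons ⟨r, es j, ⟨a, u.comp (NCtx.around i ts k), ts k, v⟩ :: U,
        .arrows (G.ty e₀) (S.arity a j) (.arrows (G.ty g) (S.arity a j) N)⟩ T')
  -- vertices labelled `C^R_𝔸`: leaving and entering the box
  | rec_res_pos {v a e₀ es g i ts U T r P T'} : G.link v = .recC a e₀ es g →
      InT G T → T.label = ⟨⟨a, .mk i ts⟩, e₀, U, .hole⟩ → PosFocus P (G.ty g) →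
      InT G T' → T'.label = ⟨r, es i, ⟨a, .hole, .mk i ts, v⟩ :: U,
        .arrows (G.ty e₀) (S.arity a i) (.arrows (G.ty g) (S.arity a i) P)⟩ →
      InT G (.cons ⟨r, g, U, P⟩ T')
  | rec_res_neg {v a e₀ es g i ts U T r N T'} : G.link v = .recC a e₀ es g →
      InT G T → T.label = ⟨⟨a, .mk i ts⟩, e₀, U, .hole⟩ → NegFocus N (G.ty g) →
      InT G T' → T'.label = ⟨r, g, U, N⟩ →
      InT G (.cons ⟨r, es i, ⟨a, .hole, .mk i ts, v⟩ :: U,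
        .arrows (G.ty e₀) (S.arity a i) (.arrows (G.ty g) (S.arity a i) N)⟩ T')
  -- vertices labelled `C^R_𝔸`: subterms of the recursion argument are passed to the branches
  | rec_arg {v a e₀ es g u i ts U T} (j : Fin (S.arity a i)) : G.link v = .recC a e₀ es g →
      InT G T → T.label = ⟨⟨a, NCtx.fill u (.mk i ts)⟩, e₀, U, .hole⟩ →
      InT G (.cons ⟨⟨a, ts j⟩, es i, ⟨a, u, .mk i ts, v⟩ :: U,
          .argAt (G.ty e₀) (S.arity a i) j .hole ((G.ty g).arrows (S.arity a i) (G.ty g))⟩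
        (T.sub (u.comp (NCtx.around i ts j))))
  -- vertices labelled `P^R_𝔸`
  | recP {w e g v e₀ b u s U T t T'} : G.link w = .recP e g → G.box g = some v →
      G.rho v = some e₀ → InT G T → T.label = ⟨⟨b, NCtx.fill u s⟩, e₀, U, .hole⟩ →
      InT G T' → T'.label = ⟨t, e, U, .hole⟩ →
      InT G (.cons ⟨t, g, ⟨b, u, s, v⟩ :: U, .hole⟩ T')

end ACS

namespace ACS

variable {S : AlgFamily}

/-! ### Polarities of type contexts -/

/-! The graph of `π` stays fixed while the term reduces; no graph is ever built for `N`. For each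
edge and stack, a wire of the graph records which pairs of an algebra term and a focus occur in root
labels of trees. `Flow T` is a type system whose judgements carry such wires: forwarding along a
type sends positive pairs one way and negative pairs back, and every wire feeding an argument must
lie in `T`. The system has no linearity, so its soundness does not depend on how variables are
shared.

Three facts carry the theorem. `Deriv.flow`: the wires of the graph form a flow for `M`, with `T`
the set of terms that reach some edge, because each closure condition on `T(G)` is one of the
forwarding conditions. Linearity matters only here: contraction and the premises of boxes forward in
one direction, which suffices because their types are base types. `Flow.steps`: flows survive
reduction with `T` unchanged. A beta step composes the forwardings through the function's wire;
unfolding a recursion replaces the family of wires indexed by (context, subterm) with the subfamily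
below the chosen immediate subterm. `Flow.of_redexArg`: an algebra term with a flow puts itself on
its own wire (`Flow.toTm_inv`), so the argument of a redex lies in `T`.

Only root labels of trees are used; the shape of the subtrees, and hence `Tree.sub`, plays no role.
-/

theorem PosFocus.left {L : TyCtx S} {A : Ty S} (B : Ty S) (h : PosFocus L A) :
    NegFocus (.left L B) (.arr A B) := by
  obtain ⟨h, a, m, rfl⟩ := h
  exact ⟨by simp [TyCtx.positive, h], a, m, rfl⟩

theorem NegFocus.left {L : TyCtx S} {A : Ty S} (B : Ty S) (h : NegFocus L A) :
    PosFocus (.left L B) (.arr A B) := by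
  obtain ⟨h, a, m, rfl⟩ := h
  exact ⟨by simp [TyCtx.positive, h], a, m, rfl⟩

theorem PosFocus.right {L : TyCtx S} {B : Ty S} (A : Ty S) (h : PosFocus L B) :
    PosFocus (.right A L) (.arr A B) := by
  obtain ⟨h, a, m, rfl⟩ := h
  exact ⟨h, a, m, rfl⟩

theorem NegFocus.right {L : TyCtx S} {B : Ty S} (A : Ty S) (h : NegFocus L B) :
    NegFocus (.right A L) (.arr A B) := by
  obtain ⟨h, a, m, rfl⟩ := h
  exact ⟨h, a, m, rfl⟩

theorem posFocus_hole (a : Fin S.n) (m : ℕ) : PosFocus .hole (.base a m) := ⟨rfl, a, m, rfl⟩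

/-- Together with `not_negFocus_base`, this makes traffic at a base type one-way, which is what
permits sharing there. -/
theorem PosFocus.eq_hole {L : TyCtx S} {a : Fin S.n} {m : ℕ} (h : PosFocus L (.base a m)) :
    L = .hole := by
  obtain ⟨-, b, l, h⟩ := h
  cases L <;> first | rfl | cases h

theorem not_negFocus_base {L : TyCtx S} {a : Fin S.n} {m : ℕ} : ¬ NegFocus L (.base a m) := by
  rintro ⟨h, b, l, h'⟩
  cases L <;> first | cases h | cases h'

theorem PosFocus.arrows {L : TyCtx S} {B : Ty S} (A : Ty S) (h : PosFocus L B) (n : ℕ) :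
    PosFocus (.arrows A n L) (A.arrows n B) := by
  induction n with
  | zero => exact h
  | succ n ih => exact ih.right A

theorem NegFocus.arrows {L : TyCtx S} {B : Ty S} (A : Ty S) (h : NegFocus L B) (n : ℕ) :
    NegFocus (.arrows A n L) (A.arrows n B) := by
  induction n with
  | zero => exact h
  | succ n ih => exact ih.right A

theorem TyCtx.argAt_zero (A : Ty S) (n : ℕ) (L : TyCtx S) (B : Ty S) :
    TyCtx.argAt A (n + 1) 0 L B = .left L (A.arrows n B) := rfl

theorem TyCtx.argAt_succ (A : Ty S) (n : ℕ) (j : Fin n) (L : TyCtx S) (B : Ty S) :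
    TyCtx.argAt A (n + 1) j.succ L B = .right A (TyCtx.argAt A n j L B) := by
  have : n + 1 - 1 - (j.1 + 1) = n - 1 - j.1 := by omega
  simp only [TyCtx.argAt, Fin.val_succ, TyCtx.arrows, this]

theorem PosFocus.argAt {L : TyCtx S} {A : Ty S} (h : PosFocus L A) (B : Ty S) {n : ℕ}
    (j : Fin n) : NegFocus (.argAt A n j L B) (A.arrows n B) := by
  induction n with
  | zero => exact j.elim0
  | succ n ih =>
    refine Fin.cases ?_ (fun j => ?_) j
    · exact h.left _
    · rw [TyCtx.argAt_succ]
      exact (ih j).right A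

theorem NegFocus.argAt {L : TyCtx S} {A : Ty S} (h : NegFocus L A) (B : Ty S) {n : ℕ}
    (j : Fin n) : PosFocus (.argAt A n j L B) (A.arrows n B) := by
  induction n with
  | zero => exact j.elim0
  | succ n ih =>
    refine Fin.cases ?_ (fun j => ?_) j
    · exact h.left _
    · rw [TyCtx.argAt_succ]
      exact (ih j).right A

/-- With `argAt_ne_arrows`, this lets a focus of a constructor's type determine which argument it
addresses, or that it addresses the result. -/
theorem TyCtx.argAt_hole_injective {A B : Ty S} {n : ℕ} {i j : Fin n}
    (h : TyCtx.argAt A n i .hole B = TyCtx.argAt A n j .hole B) : i = j := by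
  induction n with
  | zero => exact i.elim0
  | succ n ih =>
    cases i using Fin.cases <;> cases j using Fin.cases
    · rfl
    · rw [argAt_zero, argAt_succ] at h
      cases h
    · rw [argAt_zero, argAt_succ] at h
      cases h
    · rw [argAt_succ, argAt_succ] at h
      injection h with _ h
      rw [ih h]

theorem TyCtx.argAt_ne_arrows {A B : Ty S} {n : ℕ} {j : Fin n} :
    TyCtx.argAt A n j .hole B ≠ .arrows A n .hole := by
  induction n with
  | zero => exact j.elim0
  | succ n ih =>
    intro h
    cases j using Fin.cases
    · rw [argAt_zero] at h
      cases h
    · rw [argAt_succ] at h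
      injection h with _ h
      exact ih h

/-! ### Term contexts -/

theorem NCtx.fill_comp {a : Fin S.n} (u w : NCtx S a) (t : Alg S a) :
    (u.comp w).fill t = u.fill (w.fill t) := by
  induction u with
  | hole => rfl
  | node c j u ts ih => simp [comp, fill, ih]

theorem NCtx.fill_around {a : Fin S.n} (c : Fin (S.k a)) (ts : Fin (S.arity a c) → Alg S a)
    (j : Fin (S.arity a c)) : (around c ts j).fill (ts j) = .mk c ts := by
  unfold around fill
  congr 1
  funext i
  by_cases h : i = j
  · subst h
    simp [fill]
  · simp [h]

/-! ### Flow types -/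

/-- What passes through an edge: pairs of an algebra term and a focus of the type of the edge. -/
abbrev Wire (S : AlgFamily) : Type := ETerm S → TyCtx S → Prop

/-- Forwarding from the wire `p` to the wire `q` along the type `A`: positive pairs pass
from `p` to `q`, negative pairs from `q` to `p`. -/
structure Wire.Le (A : Ty S) (p q : Wire S) : Prop where
  pos : ∀ {t P}, PosFocus P A → p t P → q t P
  neg : ∀ {t N}, NegFocus N A → q t N → p t N

theorem Wire.Le.refl (A : Ty S) (p : Wire S) : Wire.Le A p p := ⟨fun _ h => h, fun _ h => h⟩

theorem Wire.Le.trans {A : Ty S} {p q r : Wire S} (h : Wire.Le A p q) (h' : Wire.Le A q r) :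
    Wire.Le A p r :=
  ⟨fun hP x => h'.pos hP (h.pos hP x), fun hN x => h.neg hN (h'.neg hN x)⟩

/-- The part of the wire `p` at the focuses `φ L`, as a wire of its own: the wire of an argument or of
the result inside the wire of a function. -/
def Wire.comap (p : Wire S) (φ : TyCtx S → TyCtx S) : Wire S := fun t L => p t (φ L)

theorem Wire.le_base {a : Fin S.n} {m : ℕ} {p q : Wire S} (h : ∀ t, p t .hole → q t .hole) :
    Wire.Le (.base a m) p q where
  pos hP := by
    rw [hP.eq_hole]
    exact h _
  neg hN := (not_negFocus_base hN).elim

/-- Flow contexts: the types and wires at which a variable may be used. -/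
abbrev FlowCtx (S : AlgFamily) : Type := ℕ → Ty S → Wire S → Prop

/-- The flow context of the body of an abstraction. -/
def FlowCtx.bind (Γ : FlowCtx S) (A : Ty S) (p : Wire S) : FlowCtx S
  | 0, B, q => B = A ∧ q = p
  | x + 1, B, q => Γ x B q

/-- `Flow T Γ M A p`: the term `M` has type `A`, and the wires of its subterms can be chosen such
that they are closed under the rules of the context semantics, that `p` is the wire of `M`
itself, and that all terms that reach the argument of an application, a conditional or a
recursion satisfy `T`.  Variables need not be used linearly. -/
inductive Flow (T : ETerm S → Prop) : FlowCtx S → Tm S → Ty S → Wire S → Prop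
  | var {Γ : FlowCtx S} {x A q p} : Γ x A q → Wire.Le A q p → Flow T Γ (.var x) A p
  | con {Γ : FlowCtx S} {a c m B p} : B = (Ty.base a m).arrows (S.arity a c) (.base a m) →
      (∀ ts : Fin (S.arity a c) → Alg S a,
        (∀ j, p ⟨a, ts j⟩ (.argAt (.base a m) (S.arity a c) j .hole (.base a m))) →
        p ⟨a, .mk c ts⟩ (.arrows (.base a m) (S.arity a c) .hole)) →
      Flow T Γ (.con a c) B p
  | lam {Γ : FlowCtx S} {M A B q p r} : Flow T (Γ.bind A q) M B p →
      Wire.Le A (r.comap fun L => .left L B) q → Wire.Le B p (r.comap (.right A)) →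
      Flow T Γ (.lam M) (.arr A B) r
  | app {Γ : FlowCtx S} {M N A B r q p} : Flow T Γ M (.arr A B) r → Flow T Γ N A q →
      (∀ t L, q t L → T t) →
      Wire.Le A q (r.comap fun L => .left L B) → Wire.Le B (r.comap (.right A)) p →
      Flow T Γ (.app M N) B p
  -- Every branch needs a flow, selected or not, since redexes inside the branches of a conditional
  -- count in `RedexArg`.
  | cond {Γ : FlowCtx S} {L a m C p₀ p} {n : ℕ} {Ms : Fin n → Tm S} {ps : Fin (S.k a) → Wire S}
      (hn : S.k a = n) : Flow T Γ L (.base a m) p₀ → (∀ t L, p₀ t L → T t) →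
      (∀ i, Flow T Γ (Ms (i.cast hn)) ((Ty.base a m).arrows (S.arity a i) C) (ps i)) →
      (∀ i ts, p₀ ⟨a, .mk i ts⟩ .hole →
        Wire.Le C ((ps i).comap (.arrows (.base a m) (S.arity a i))) p ∧
        ∀ j, ps i ⟨a, ts j⟩ (.argAt (.base a m) (S.arity a i) j .hole C)) →
      Flow T Γ (.cond L Ms) C p
  -- One wire per copy of a branch, indexed by the position `u` and the subterm `s` it treats. Only
  -- copies below a term on `p₀` need a flow: the stacks of other copies need not be legal. The
  -- wires `q` must lie in `T` because unfolding turns recursive results into arguments of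
  -- applications.
  | recur {Γ : FlowCtx S} {L a m C p₀ p} {n : ℕ} {Ms : Fin n → Tm S}
      {q : NCtx S a → Alg S a → Wire S}
      (hn : S.k a = n) : Flow T Γ L (.base a m) p₀ → (∀ t L, p₀ t L → T t) →
      (∀ u s t L, q u s t L → T t) →
      (∀ u i ts, p₀ ⟨a, NCtx.fill u (.mk i ts)⟩ .hole →
        Flow T Γ (Ms (i.cast hn))
          ((Ty.base a m).arrows (S.arity a i) (C.arrows (S.arity a i) C)) (q u (.mk i ts))) →
      (∀ u i ts, p₀ ⟨a, NCtx.fill u (.mk i ts)⟩ .hole → ∀ j, q u (.mk i ts) ⟨a, ts j⟩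
        (.argAt (.base a m) (S.arity a i) j .hole (C.arrows (S.arity a i) C))) →
      (∀ u i ts, p₀ ⟨a, NCtx.fill u (.mk i ts)⟩ .hole → ∀ k j ss, ts k = .mk j ss →
        Wire.Le C
          ((q (u.comp (NCtx.around i ts k)) (.mk j ss)).comap fun L =>
            .arrows (.base a m) (S.arity a j) (.arrows C (S.arity a j) L))
          ((q u (.mk i ts)).comap fun L =>
            .arrows (.base a m) (S.arity a i) (.argAt C (S.arity a i) k L C))) →
      (∀ i ts, p₀ ⟨a, .mk i ts⟩ .hole →
        Wire.Le C ((q .hole (.mk i ts)).comap fun L =>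
            .arrows (.base a m) (S.arity a i) (.arrows C (S.arity a i) L)) p) →
      Flow T Γ (.recur L Ms) C p

/-! ### Enlarging wires, renaming and substitution -/

namespace Flow

variable {T : ETerm S → Prop}

/-- Every rule ends in a forwarding to the outer wire, so a further forwarding can be composed with
it; for a constructor and an abstraction it is also run backwards at the argument focuses. -/
theorem mono {Γ : FlowCtx S} {M : Tm S} {A : Ty S} {p p' : Wire S} (h : Flow T Γ M A p)
    (hp : Wire.Le A p p') : Flow T Γ M A p' := by
  cases h with
  | var hx hq => exact .var hx (hq.trans hp)
  | con hB hc =>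
    subst hB
    refine .con rfl fun ts hts => hp.pos ((posFocus_hole _ _).arrows _ _) (hc ts fun j => ?_)
    exact hp.neg ((posFocus_hole _ _).argAt _ j) (hts j)
  | lam hM hq hr =>
    refine .lam hM ⟨fun hP h => hq.pos hP (hp.neg (hP.left _) h), fun hN h => ?_⟩
      ⟨fun hP h => ?_, fun hN h => hr.neg hN (hp.neg (hN.right _) h)⟩
    · exact hp.pos (hN.left _) (hq.neg hN h)
    · exact hp.pos (hP.right _) (hr.pos hP h)
  | app hM hN hT hq hr => exact .app hM hN hT hq (hr.trans hp)
  | cond hn hL hT hMs h =>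
    exact .cond hn hL hT hMs fun i ts hi => ⟨(h i ts hi).1.trans hp, (h i ts hi).2⟩
  | recur hn hL hT hq hMs harg hcopy h =>
    exact .recur hn hL hT hq hMs harg hcopy fun i ts hi => (h i ts hi).trans hp

/-- The renaming need not be injective: merging two variables is allowed as soon as one wire
forwards to both. This is the form that contraction uses. -/
theorem rename {Γ : FlowCtx S} {M : Tm S} {A : Ty S} {p : Wire S} (h : Flow T Γ M A p)
    {Δ : FlowCtx S} {ρ : ℕ → ℕ}
    (hρ : ∀ x B q, Γ x B q → ∃ q', Δ (ρ x) B q' ∧ Wire.Le B q' q) :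
    Flow T Δ (M.rename ρ) A p := by
  induction h generalizing Δ ρ with
  | var hx hq =>
    obtain ⟨q', hq', hle⟩ := hρ _ _ _ hx
    exact .var hq' (hle.trans hq)
  | con hB hc => exact .con hB hc
  | lam hM hq hr ih =>
    refine .lam (ih fun x B q hx => ?_) hq hr
    cases x with
    | zero => exact ⟨q, hx, .refl _ _⟩
    | succ x => exact hρ x B q hx
  | app hM hN hT hq hr ihM ihN => exact .app (ihM hρ) (ihN hρ) hT hq hr
  | cond hn hL hT hMs h ihL ihMs => exact .cond hn (ihL hρ) hT (fun i => ihMs i hρ) h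
  | recur hn hL hT hq hMs harg hcopy h ihL ihMs =>
    exact .recur hn (ihL hρ) hT hq (fun u i ts hi => ihMs u i ts hi hρ) harg hcopy h

/-- Contexts are never split between subterms, so the flow of a substituted term may be copied to
every occurrence of its variable, including those in branches. -/
theorem subst {Γ : FlowCtx S} {M : Tm S} {A : Ty S} {p : Wire S} (h : Flow T Γ M A p)
    {Δ : FlowCtx S} {s : ℕ → Tm S} (hs : ∀ x B q, Γ x B q → Flow T Δ (s x) B q) :
    Flow T Δ (M.subst s) A p := by
  induction h generalizing Δ s with
  | var hx hq => exact (hs _ _ _ hx).mono hq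
  | con hB hc => exact .con hB hc
  | lam hM hq hr ih =>
    refine .lam (ih fun x B q hx => ?_) hq hr
    cases x with
    | zero => exact .var hx (.refl _ _)
    | succ x => exact (hs x B q hx).rename fun y B' q' hy => ⟨q', hy, .refl _ _⟩
  | app hM hN hT hq hr ihM ihN => exact .app (ihM hs) (ihN hs) hT hq hr
  | cond hn hL hT hMs h ihL ihMs => exact .cond hn (ihL hs) hT (fun i => ihMs i hs) h
  | recur hn hL hT hq hMs harg hcopy h ihL ihMs =>
    exact .recur hn (ihL hs) hT hq (fun u i ts hi => ihMs u i ts hi hs) harg hcopy h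

theorem inst {Γ : FlowCtx S} {M V : Tm S} {A B : Ty S} {p q : Wire S}
    (hM : Flow T (Γ.bind A q) M B p) (hV : Flow T Γ V A q) : Flow T Γ (M.inst V) B p := by
  refine hM.subst fun x C r hx => ?_
  cases x with
  | zero =>
    obtain ⟨rfl, rfl⟩ := hx
    exact hV
  | succ x => exact .var hx (.refl _ _)

/-! ### Iterated applications and free algebra terms -/

theorem apps {Γ : FlowCtx S} {A B : Ty S} {n : ℕ} {M : Tm S} {Ns : Fin n → Tm S} {r p : Wire S}
    {w : Fin n → Wire S} (hM : Flow T Γ M (A.arrows n B) r) (hN : ∀ j, Flow T Γ (Ns j) A (w j))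
    (hT : ∀ j t L, w j t L → T t)
    (hw : ∀ j, Wire.Le A (w j) (r.comap fun L => .argAt A n j L B))
    (hp : Wire.Le B (r.comap (.arrows A n)) p) : Flow T Γ (M.apps Ns) B p := by
  induction n generalizing M r with
  | zero => exact hM.mono hp
  | succ n ih =>
    refine ih (r := r.comap (.right A)) (w := fun j => w j.succ)
      (.app hM (hN 0) (hT 0) (hw 0) (.refl _ _)) (fun j => hN j.succ) (fun j => hT j.succ)
      (fun j => ?_) hp
    have := hw j.succ
    simp only [TyCtx.argAt_succ] at this
    exact this

/-- Peeling off arguments reveals the type of the head only at the end, so the information about the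
arguments is conditional on an equation for that type. Forwardings for the later arguments are
pulled back through the result of the first application. -/
theorem apps_inv {Γ : FlowCtx S} {B : Ty S} {n : ℕ} {M : Tm S} {Ns : Fin n → Tm S} {p : Wire S}
    (h : Flow T Γ (M.apps Ns) B p) :
    ∃ A' r, Flow T Γ M A' r ∧ ∀ A B', A' = A.arrows n B' → B' = B ∧ ∃ w : Fin n → Wire S,
      (∀ j, Flow T Γ (Ns j) A (w j)) ∧ (∀ j t L, w j t L → T t) ∧
      (∀ j, Wire.Le A (w j) (r.comap fun L => .argAt A n j L B)) ∧
      Wire.Le B (r.comap (.arrows A n)) p := by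
  induction n generalizing M with
  | zero =>
    refine ⟨B, p, h, fun A B' hA => ⟨hA.symm, Fin.elim0, fun j => j.elim0, fun j => j.elim0,
      fun j => j.elim0, .refl _ _⟩⟩
  | succ n ih =>
    obtain ⟨A', r, hM, hr⟩ := ih (M := M.app (Ns 0)) h
    cases hM with
    | @app _ _ _ A₀ _ r₀ q _ hM hN hT hq hr₀ =>
      refine ⟨_, _, hM, fun A B' hA => ?_⟩
      injection hA with hA hA'
      subst hA
      obtain ⟨rfl, w, hw, hwT, hwr, hp⟩ := hr _ _ hA'
      subst hA'
      refine ⟨rfl, Fin.cons q w, Fin.cases hN hw, Fin.cases hT hwT, fun j => ?_, ?_⟩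
      · cases j using Fin.cases with
        | zero => exact hq
        | succ j =>
          simp only [TyCtx.argAt_succ, Fin.cons_succ]
          -- Passing to an argument position reverses polarity, so `hr₀` is used in the direction
          -- opposite to that of `hwr j`.
          exact ⟨fun hP h => hr₀.neg (hP.argAt _ j) ((hwr j).pos hP h),
            fun hN h => (hwr j).neg hN (hr₀.pos (hN.argAt _ j) h)⟩
      · exact ⟨fun hP h => hp.pos hP (hr₀.pos (hP.arrows _ _) h),
          fun hN h => hr₀.neg (hN.arrows _ _) (hp.neg hN h)⟩

/-- The head constructor gets the least useful wire: each argument at its own focus and the whole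
term at the result focus. Its closure condition then produces nothing but the term itself. -/
theorem toTm_mk {Γ : FlowCtx S} {a : Fin S.n} {m : ℕ} {c : Fin (S.k a)}
    {ts : Fin (S.arity a c) → Alg S a} {p : Wire S}
    (hts : ∀ j p, p ⟨a, ts j⟩ .hole → Flow T Γ (ts j).toTm (.base a m) p)
    (hT : ∀ j, T ⟨a, ts j⟩) (hp : p ⟨a, .mk c ts⟩ .hole) :
    Flow T Γ (Alg.mk c ts).toTm (.base a m) p := by
  let r : Wire S := fun t L =>
    (∃ j, L = .argAt (.base a m) (S.arity a c) j .hole (.base a m) ∧ t = ⟨a, ts j⟩) ∨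
      (L = .arrows (.base a m) (S.arity a c) .hole ∧ t = ⟨a, .mk c ts⟩)
  refine apps (r := r) (w := fun j t L => t = ⟨a, ts j⟩ ∧ L = .hole) (.con rfl fun ts' h => ?_)
    (fun j => hts j _ ⟨rfl, rfl⟩) (fun j t L h => h.1 ▸ hT j)
    (fun j => Wire.le_base fun t h => .inl ⟨j, rfl, h.1⟩) (Wire.le_base fun t h => ?_)
  · refine .inr ⟨rfl, ?_⟩
    congr 2
    funext j
    rcases h j with ⟨i, hi, h⟩ | ⟨h, -⟩
    · rw [← TyCtx.argAt_hole_injective hi] at h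
      simpa using h
    · exact (TyCtx.argAt_ne_arrows h).elim
  · rcases h with ⟨j, h, -⟩ | ⟨-, h⟩
    · exact (TyCtx.argAt_ne_arrows h.symm).elim
    · exact h ▸ hp

/-- The arguments put themselves on their wires by induction, the constructor rule assembles them,
and the result is forwarded to `p`. Since `toTm_mk` accepts any wire containing the term, algebra
terms can afterwards be given singleton wires; this is what makes them freely reusable when a redex
fires. -/
theorem toTm_inv {Γ : FlowCtx S} {a : Fin S.n} {t : Alg S a} {B : Ty S} {p : Wire S}
    (h : Flow T Γ t.toTm B p) :
    ∃ m, B = .base a m ∧ p ⟨a, t⟩ .hole ∧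
      (∀ p', p' ⟨a, t⟩ .hole → Flow T Γ t.toTm (.base a m) p') ∧
      ∀ c ts, t = .mk c ts → ∀ j, T ⟨a, ts j⟩ ∧
        ∀ p', p' ⟨a, ts j⟩ .hole → Flow T Γ (ts j).toTm (.base a m) p' := by
  induction t generalizing B p with
  | mk c ts ih =>
    obtain ⟨A', r, hc, hr⟩ := apps_inv (M := .con a c) (Ns := fun i => (ts i).toTm) h
    cases hc with
    | con hB hc =>
      rename_i m
      obtain ⟨rfl, w, hw, hT, hwr, hp⟩ := hr _ _ hB
      have key : ∀ j, w j ⟨a, ts j⟩ .hole ∧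
          ∀ p', p' ⟨a, ts j⟩ .hole → Flow T Γ (ts j).toTm (.base a m) p' := by
        intro j
        obtain ⟨m', hm, h₁, h₂, -⟩ := ih j (hw j)
        cases hm
        exact ⟨h₁, h₂⟩
      refine ⟨m, rfl, hp.pos (posFocus_hole _ _)
        (hc ts fun j => (hwr j).pos (posFocus_hole _ _) (key j).1),
        fun p' => toTm_mk (fun j => (key j).2) (fun j => hT j _ _ (key j).1), ?_⟩
      intro c' ts' h
      cases h
      exact fun j => ⟨hT j _ _ (key j).1, (key j).2⟩

/-! ### Subject reduction -/

theorem red {Γ : FlowCtx S} {M N : Tm S} {A : Ty S} {p : Wire S} (h : Flow T Γ M A p)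
    (hMN : Red M N) : Flow T Γ N A p := by
  cases hMN with
  | beta hV =>
    cases h with
    | app hM hN hT hq hr =>
      cases hM with
      -- The wire of the abstraction is cut out: the argument is forwarded through it to the
      -- variable, the body through it to the result.
      | lam hM hq' hr' => exact (hM.mono (hr'.trans hr)).inst (hN.mono (hq.trans hq'))
  | @cond a c ts Ms =>
    cases h with
    | cond hn hL hT hMs h =>
      obtain ⟨m', hm, h₀, -, hts⟩ := hL.toTm_inv
      cases hm
      obtain ⟨h₁, h₂⟩ := h c ts h₀
      refine apps (w := fun j t L => t = ⟨a, ts j⟩ ∧ L = .hole) (hMs c)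
        (fun j => (hts c ts rfl j).2 _ ⟨rfl, rfl⟩)
        (fun j t L h => h.1 ▸ (hts c ts rfl j).1) (fun j => Wire.le_base fun t h => ?_) h₁
      rw [h.1]
      exact h₂ j
  | @recur a c ts Ms =>
    cases h with
    | @recur _ _ _ m _ _ _ _ _ q hn hL hT hq hMs harg hcopy h =>
      obtain ⟨m', hm, h₀, -, hts⟩ := hL.toTm_inv
      cases hm
      -- The redex is the copy at the root position `.hole`. The outer spine passes the recursive
      -- results, whose wires are exactly the parts of the copy's wire at those arguments; the inner
      -- spine passes the subterms.
      refine apps (r := (q .hole (.mk c ts)).comap (.arrows (.base a m) (S.arity a c)))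
        (w := fun k => (q .hole (.mk c ts)).comap fun L =>
            .arrows (.base a m) (S.arity a c) (.argAt A (S.arity a c) k L A))
        (apps (w := fun j t L => t = ⟨a, ts j⟩ ∧ L = .hole) (hMs .hole c ts h₀)
          (fun j => (hts c ts rfl j).2 _ ⟨rfl, rfl⟩)
          (fun j t L h => h.1 ▸ (hts c ts rfl j).1) (fun j => Wire.le_base fun t h => ?_)
          (.refl _ _))
        (fun k => ?_) (fun j t L h => hq _ _ _ _ h) (fun j => .refl _ _) (h c ts h₀)
      · rw [h.1]
        exact harg .hole c ts h₀ j
      -- A position inside `ts k` becomes a position inside the whole term once `around c ts k` is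
      -- put around it, so the old conditions at `p₀` apply to the new recursion.
      · have fill_eq : ∀ (u : NCtx S a) (s : Alg S a), u.fill s = ts k →
            ((NCtx.around c ts k).comp u).fill s = .mk c ts := by
          intro u s hu
          rw [NCtx.fill_comp, hu, NCtx.fill_around]
        have term_eq : ∀ {t t' : Alg S a}, (⟨a, t⟩ : ETerm S) = ⟨a, t'⟩ → t = t' := by
          intro t t' h
          simpa using h
        refine .recur (p₀ := fun t L => t = ⟨a, ts k⟩ ∧ L = .hole)
          (q := fun u => q ((NCtx.around c ts k).comp u)) hn
          ((hts c ts rfl k).2 _ ⟨rfl, rfl⟩) (fun t L h => h.1 ▸ (hts c ts rfl k).1)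
          (fun u => hq _) (fun u i ts' h => hMs _ i ts' ?_) (fun u i ts' h => harg _ i ts' ?_)
          (fun u i ts' h => hcopy ((NCtx.around c ts k).comp u) i ts' ?_)
          -- The result of the inner recursion is the transfer from the copy for `ts k` to the copy
          -- for the whole term.
          (fun i ts' h => hcopy .hole c ts h₀ k i ts' (term_eq h.1).symm)
        all_goals
          rw [fill_eq _ _ (term_eq h.1)]
          exact h₀

theorem step {Γ : FlowCtx S} {M N : Tm S} {A : Ty S} {p : Wire S} (h : Flow T Γ M A p)
    (hMN : Step M N) : Flow T Γ N A p := by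
  induction hMN generalizing A p with
  | red hMN => exact h.red hMN
  | appL _ ih =>
    cases h with
    | app hM hN hT hq hr => exact .app (ih hM) hN hT hq hr
  | appR _ ih =>
    cases h with
    | app hM hN hT hq hr => exact .app hM (ih hN) hT hq hr
  | cond _ ih =>
    cases h with
    | cond hn hL hT hMs h => exact .cond hn (ih hL) hT hMs h
  | recur _ ih =>
    cases h with
    | recur hn hL hT hq hMs harg hcopy h => exact .recur hn (ih hL) hT hq hMs harg hcopy h

theorem steps {Γ : FlowCtx S} {M N : Tm S} {A : Ty S} {p : Wire S} (h : Flow T Γ M A p)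
    (hMN : Steps M N) : Flow T Γ N A p := by
  induction hMN with
  | refl => exact h
  | tail _ hs ih => exact ih.step hs

/-- Each rule that consumes an argument bounds its wire by `T`, and by `toTm_inv` an algebra term
lies on its own wire. The induction enters all positions except branches of a recursion, where a
flow need not exist. -/
theorem of_redexArg {Γ : FlowCtx S} {N : Tm S} {A : Ty S} {p : Wire S} (h : Flow T Γ N A p)
    {a : Fin S.n} {t : Alg S a} (ht : RedexArg N t) : T ⟨a, t⟩ := by
  have arg : ∀ {Γ : FlowCtx S} {A : Ty S} {p : Wire S} {t : Alg S a}, Flow T Γ t.toTm A p →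
      (∀ t L, p t L → T t) → T ⟨a, t⟩ := by
    intro Γ A p t h hT
    obtain ⟨m, -, h, -⟩ := h.toTm_inv
    exact hT _ _ h
  induction ht generalizing Γ A p with
  | beta M t =>
    cases h with
    | app hM hN hT hq hr => exact arg hN hT
  | condRedex t Ms =>
    cases h with
    | cond hn hL hT hMs h => exact arg hL hT
  | recRedex t Ms =>
    cases h with
    | recur hn hL hT hq hMs harg hcopy h => exact arg hL hT
  | appL _ ih =>
    cases h with
    | app hM hN hT hq hr => exact ih hM
  | appR _ ih =>
    cases h with
    | app hM hN hT hq hr => exact ih hN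
  | lam _ ih =>
    cases h with
    | lam hM hq hr => exact ih hM
  | cond _ ih =>
    cases h with
    | cond hn hL hT hMs h => exact ih hL
  | condBranch i _ ih =>
    cases h with
    | cond hn hL hT hMs h => exact ih (hMs (i.cast hn.symm))
  | recur _ ih =>
    cases h with
    | recur hn hL hT hq hMs harg hcopy h => exact ih hL

end Flow

/-! ### The flow of a derivation -/

/-- Disjointness of the domains makes the component picked by choice the only possible one. -/
theorem joinPrem_eq {ι E : Type} {Γs : ι → Ctx S} {Θ : Ctx S} (h : IsJoin Γs Θ)
    (p : ∀ i x, (Γs i x).isSome → E) {x : ℕ} (hx : (Θ x).isSome) {i : ι}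
    (hi : (Γs i x).isSome) : joinPrem h p x hx = p i x hi := by
  have : ∀ j (hj : (Γs j x).isSome), p j x hj = p i x hi := by
    intro j hj
    obtain rfl := h.disjoint x j i hj hi
    rfl
  exact this _ _

theorem IsJoin.eq {ι : Type} {Γs : ι → Ctx S} {Θ : Ctx S} (h : IsJoin Γs Θ) {x : ℕ} {i : ι}
    {A : Ty S} (hi : Γs i x = some A) : Θ x = some A :=
  (h.mem_iff x A).2 ⟨i, hi⟩

theorem Deriv.ty_concl {D : Set (Ty S)} {Γ : Ctx S} {M : Tm S} {A : Ty S} (π : Deriv D Γ M A) :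
    π.graph.ty π.graph.concl = A := by
  induction π with
  | weak x A hx π ih => exact ih
  | contr x y z A hA hxy hx hy hz hN π ih => exact ih
  | con a c m hB => exact hB.symm
  | _ => rfl

theorem Deriv.ty_prem {D : Set (Ty S)} {Γ : Ctx S} {M : Tm S} {A : Ty S} (π : Deriv D Γ M A)
    {x : ℕ} {B : Ty S} (hx : Γ x = some B) (hx' : (Γ x).isSome) :
    π.graph.ty (π.graph.prem x hx') = B := by
  induction π generalizing x B with
  | ax y A =>
    by_cases h : x = y
    · exact (by simpa [Ctx.add, h] using hx : A = B)
    · simp [Ctx.add, Ctx.empty, h] at hx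
  | weak y A hy π ih =>
    by_cases h : x = y
    · simpa [Deriv.graph, IGraph.weakG, Ctx.add, h] using hx
    · simpa [Deriv.graph, IGraph.weakG, h] using
        ih (by simpa [Ctx.add, h] using hx) (Ctx.isSome_of_add hx' h)
  | @contr Γ' _ _ _ y y' z A hA hxy hy hy' hz hN π ih =>
    by_cases h : x = z
    · simpa [Deriv.graph, IGraph.contrG, Ctx.add, h] using hx
    · have hΓ : Γ' x = some B := by simpa [Ctx.add, h] using hx
      have h₁ : x ≠ y := by
        rintro rfl
        simp [hy] at hΓ
      have h₂ : x ≠ y' := by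
        rintro rfl
        simp [hy'] at hΓ
      simpa [Deriv.graph, IGraph.contrG, h] using
        ih (x := x) (by simpa [Ctx.add, h₁, h₂] using hΓ) (by simp [Ctx.add, h₁, h₂, hΓ])
  | lam π ih => exact ih (x := x + 1) hx hx'
  | con => cases hx
  | app h π ξ ihM ihN =>
    obtain ⟨i, hi⟩ := (h.mem_iff x B).1 hx
    simp only [Deriv.graph, IGraph.appG]
    rw [joinPrem_eq h _ _ (i := i) (by simp [hi])]
    cases i with
    | false => exact ihM hi _
    | true => exact ihN hi _
  | cond h πs ξ ihs ih =>
    obtain ⟨i, hi⟩ := (h.mem_iff x B).1 hx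
    simp only [Deriv.graph, IGraph.condG]
    rw [joinPrem_eq h _ _ (i := i) (by simp [hi])]
    cases i with
    | none => exact ih hi _
    | some i => exact ihs i hi _
  | recur h hD πs ξ ihs ih =>
    obtain ⟨i, hi⟩ := (h.mem_iff x B).1 hx
    simp only [Deriv.graph, IGraph.recG]
    rw [joinPrem_eq h _ _ (i := i) (by simp [hi])]
    cases i with
    | none => exact ih hi _
    | some i =>
      simp only [Ctx.family] at hi
      simp [hi]

/-- A premise of a recursion's branch is replaced by an edge outside the box. Hence, seen from an
enclosing recursion, the premise edges of a branch lie directly in that recursion's box, as the rule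
for `P^R` demands. -/
theorem Deriv.box_prem {D : Set (Ty S)} {Γ : Ctx S} {M : Tm S} {A : Ty S} (π : Deriv D Γ M A)
    {x : ℕ} {B : Ty S} (hx : Γ x = some B) (hx' : (Γ x).isSome) :
    π.graph.box (π.graph.prem x hx') = none := by
  induction π generalizing x B with
  | ax y A =>
    rfl
  | weak y A hy π ih =>
    by_cases h : x = y
    · simp [Deriv.graph, IGraph.weakG, h]
    · simpa [Deriv.graph, IGraph.weakG, h] using
        ih (by simpa [Ctx.add, h] using hx) (Ctx.isSome_of_add hx' h)
  | @contr Γ' _ _ _ y y' z A hA hxy hy hy' hz hN π ih =>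
    by_cases h : x = z
    · simp [Deriv.graph, IGraph.contrG, h]
    · have hΓ : Γ' x = some B := by simpa [Ctx.add, h] using hx
      have h₁ : x ≠ y := by
        rintro rfl
        simp [hy] at hΓ
      have h₂ : x ≠ y' := by
        rintro rfl
        simp [hy'] at hΓ
      simpa [Deriv.graph, IGraph.contrG, h] using
        ih (x := x) (by simpa [Ctx.add, h₁, h₂] using hΓ) (by simp [Ctx.add, h₁, h₂, hΓ])
  | lam π ih => exact Option.map_eq_none_iff.2 (ih (x := x + 1) hx hx')
  | con => cases hx
  | app h π ξ ihM ihN =>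
    obtain ⟨i, hi⟩ := (h.mem_iff x B).1 hx
    simp only [Deriv.graph, IGraph.appG]
    rw [joinPrem_eq h _ _ (i := i) (by simp [hi])]
    cases i with
    | false => exact Option.map_eq_none_iff.2 (ihM hi _)
    | true => exact Option.map_eq_none_iff.2 (ihN hi _)
  | cond h πs ξ ihs ih =>
    obtain ⟨i, hi⟩ := (h.mem_iff x B).1 hx
    simp only [Deriv.graph, IGraph.condG]
    rw [joinPrem_eq h _ _ (i := i) (by simp [hi])]
    cases i with
    | none => exact Option.map_eq_none_iff.2 (ih hi _)
    | some i => exact Option.map_eq_none_iff.2 (ihs i hi _)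
  | recur h hD πs ξ ihs ih =>
    obtain ⟨i, hi⟩ := (h.mem_iff x B).1 hx
    simp only [Deriv.graph, IGraph.recG]
    rw [joinPrem_eq h _ _ (i := i) (by simp [hi])]
    cases i with
    | none => exact Option.map_eq_none_iff.2 (ih hi _)
    | some i => rfl

/-! ### Wires of a graph, legal stacks and embeddings of subgraphs -/

section Wires

variable {Γ₀ : Ctx S} (G : IGraph S Γ₀)

/-- The pairs that reach the edge `e` with the stack `U`. -/
def IGraph.wire (e : G.E) (U : List (Entry S G.V)) : Wire S :=
  fun t L => ∃ T, InT G T ∧ T.label = ⟨t, e, U, L⟩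

/-- The stacks of the edges with box-premise `b`. -/
def IGraph.IsStack : Option G.V → List (Entry S G.V) → Prop
  | none, U => U = []
  | some w, U => ∃ e₀ a u s U', G.rho w = some e₀ ∧ U = ⟨a, u, s, w⟩ :: U' ∧
      G.wire e₀ U' ⟨a, u.fill s⟩ .hole

/-- Maps of a graph `H` into `G` whose outermost edges have the box-premise `b`. -/
structure IGraph.Emb {Γ : Ctx S} (H : IGraph S Γ) (b : Option G.V) where
  edge : H.E → G.E
  vert : H.V → G.V
  link : ∀ v, G.link (vert v) = (H.link v).map edge
  ty : ∀ e, G.ty (edge e) = H.ty e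
  box : ∀ e, G.box (edge e) = ((H.box e).map vert).or b

variable {G}

theorem IGraph.Emb.rho {Γ : Ctx S} {H : IGraph S Γ} {b : Option G.V} (f : G.Emb H b) (v : H.V) :
    G.rho (f.vert v) = (H.rho v).map f.edge := by
  unfold IGraph.rho
  rw [f.link]
  cases H.link v <;> rfl

/-- Restricting an embedding to a subgraph. -/
def IGraph.Emb.comp {Γ Γ' : Ctx S} {H : IGraph S Γ} {K : IGraph S Γ'} {b : Option G.V}
    {c : Option H.V} (f : G.Emb H b) (g : H.Emb K c) : G.Emb K ((c.map f.vert).or b) where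
  edge e := f.edge (g.edge e)
  vert v := f.vert (g.vert v)
  link v := by
    rw [f.link, g.link]
    cases K.link v <;> rfl
  ty e := by rw [f.ty, g.ty]
  box e := by
    rw [f.box, g.box]
    cases K.box e <;> rfl

/-- The identical embedding. -/
def IGraph.Emb.id (G : IGraph S Γ₀) : G.Emb G none where
  edge e := e
  vert v := v
  link v := by cases G.link v <;> rfl
  ty _ := rfl
  box e := by cases G.box e <;> rfl

/-- The body of an abstraction. -/
def IGraph.embLam {Γ : Ctx S} (A B : Ty S) (H : IGraph S (Γ.bind A)) :
    (IGraph.lamG A B H).Emb H none :=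
  ⟨some, some, fun _ => rfl, fun _ => rfl, fun e => by cases h : H.box e <;> simp [lamG, h]⟩

/-- The graph below a weakening. -/
def IGraph.embWeak {Γ : Ctx S} (x : ℕ) (A : Ty S) (H : IGraph S Γ) :
    (IGraph.weakG x A H).Emb H none :=
  ⟨some, some, fun _ => rfl, fun _ => rfl, fun e => by cases h : H.box e <;> simp [weakG, h]⟩

/-- The graph below a contraction. -/
def IGraph.embContr {Γ : Ctx S} (x y z : ℕ) (A : Ty S) (H : IGraph S ((Γ.add x A).add y A)) :
    (IGraph.contrG x y z A H).Emb H none :=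
  ⟨some, some, fun _ => rfl, fun _ => rfl, fun e => by cases h : H.box e <;> simp [contrG, h]⟩

section

variable {Γ Δ Θ : Ctx S} (h : IsJoin (Ctx.pair Γ Δ) Θ) (B : Ty S) (H : IGraph S Γ)
  (K : IGraph S Δ)

/-- The function of an application. -/
def IGraph.embFun : (IGraph.appG h B H K).Emb H none :=
  ⟨fun e => some (.inl e), fun v => some (.inl v), fun _ => rfl, fun _ => rfl,
    fun e => by cases h : H.box e <;> simp [appG, h]⟩

/-- The argument of an application. -/
def IGraph.embArg : (IGraph.appG h B H K).Emb K none :=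
  ⟨fun e => some (.inr e), fun v => some (.inr v), fun _ => rfl, fun _ => rfl,
    fun e => by cases h : K.box e <;> simp [appG, h]⟩

end

section

variable {a : Fin S.n} {Γs : Fin (S.k a) → Ctx S} {Δ Θ : Ctx S}
  (h : IsJoin (Ctx.family Γs Δ) Θ) (C : Ty S) (Gs : ∀ i, IGraph S (Γs i)) (H : IGraph S Δ)

/-- The scrutinee of a conditional. -/
def IGraph.embCondArg : (IGraph.condG h C Gs H).Emb H none :=
  ⟨fun e => some (.inl e), fun v => some (.inl v), fun _ => rfl, fun _ => rfl,
    fun e => by cases h : H.box e <;> simp [condG, h]⟩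

/-- A branch of a conditional. -/
def IGraph.embCondBranch (i : Fin (S.k a)) : (IGraph.condG h C Gs H).Emb (Gs i) none :=
  ⟨fun e => some (.inr ⟨i, e⟩), fun v => some (.inr ⟨i, v⟩), fun _ => rfl, fun _ => rfl,
    fun e => by cases h : (Gs i).box e <;> simp [condG, h]⟩

/-- The argument of a recursion. -/
def IGraph.embRecArg : (IGraph.recG h C Gs H).Emb H none :=
  ⟨fun e => some (.inl e), fun v => some (.inl v), fun _ => rfl, fun _ => rfl,
    fun e => by cases h : H.box e <;> simp [recG, h]⟩

/-- A branch of a recursion. -/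
def IGraph.embRecBranch (i : Fin (S.k a)) : (IGraph.recG h C Gs H).Emb (Gs i) (some none) :=
  ⟨fun e => some (.inr (.inl ⟨i, e⟩)), fun v => some (.inr (.inl ⟨i, v⟩)), fun _ => rfl,
    fun _ => rfl, fun e => by cases h : (Gs i).box e <;> simp [recG, h]⟩

end

/-- `Γ` provides the variables of `H` at the types and wires of the premises. -/
def FlowCtx.Covers (Δ : FlowCtx S) {Γ : Ctx S} {H : IGraph S Γ} {b : Option G.V} (f : G.Emb H b)
    (U : List (Entry S G.V)) : Prop :=
  ∀ x A (hx : Γ x = some A), ∃ q, Δ x A q ∧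
    Wire.Le A q (G.wire (f.edge (H.prem x (by simp [hx]))) U)

/-- The terms that reach some edge. -/
def IGraph.Reaches (G : IGraph S Γ₀) (t : ETerm S) : Prop :=
  ∃ T, InT G T ∧ T.term = t

theorem IGraph.wire_reaches {e : G.E} {U : List (Entry S G.V)} (t : ETerm S) (L : TyCtx S)
    (h : G.wire e U t L) : G.Reaches t := by
  obtain ⟨T, hT, h⟩ := h
  exact ⟨T, hT, by rw [Tree.term, h]⟩

/-! ### Closure conditions of the trees as forwardings between wires -/

theorem IGraph.le_wire_of_lam_arg {v e g h} (hv : G.link v = .lam e g h)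
    (U : List (Entry S G.V)) {A B : Ty S} (hA : G.ty e = A) (hB : G.ty g = B) :
    Wire.Le A ((G.wire h U).comap fun L => .left L B) (G.wire e U) := by
  subst hA hB
  exact ⟨fun hP ⟨_, hT, hl⟩ => ⟨_, .lam_arg_pos hv hP hT hl, rfl⟩,
    fun hN ⟨_, hT, hl⟩ => ⟨_, .lam_arg_neg hv hN hT hl, rfl⟩⟩

theorem IGraph.le_wire_of_lam_res {v e g h} (hv : G.link v = .lam e g h)
    (U : List (Entry S G.V)) {A B : Ty S} (hA : G.ty e = A) (hB : G.ty g = B) :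
    Wire.Le B (G.wire g U) ((G.wire h U).comap (.right A)) := by
  subst hA hB
  exact ⟨fun hP ⟨_, hT, hl⟩ => ⟨_, .lam_res_pos hv hP hT hl, rfl⟩,
    fun hN ⟨_, hT, hl⟩ => ⟨_, .lam_res_neg hv hN hT hl, rfl⟩⟩

theorem IGraph.le_wire_of_app_arg {v e g h} (hv : G.link v = .app e g h)
    (U : List (Entry S G.V)) {A B : Ty S} (hA : G.ty g = A) (hB : G.ty h = B) :
    Wire.Le A (G.wire g U) ((G.wire e U).comap fun L => .left L B) := by
  subst hA hB
  exact ⟨fun hP ⟨_, hT, hl⟩ => ⟨_, .app_arg_pos hv hP hT hl, rfl⟩,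
    fun hN ⟨_, hT, hl⟩ => ⟨_, .app_arg_neg hv hN hT hl, rfl⟩⟩

theorem IGraph.le_wire_of_app_res {v e g h} (hv : G.link v = .app e g h)
    (U : List (Entry S G.V)) {A B : Ty S} (hA : G.ty g = A) (hB : G.ty h = B) :
    Wire.Le B ((G.wire e U).comap (.right A)) (G.wire h U) := by
  subst hA hB
  exact ⟨fun hP ⟨_, hT, hl⟩ => ⟨_, .app_res_pos hv hP hT hl, rfl⟩,
    fun hN ⟨_, hT, hl⟩ => ⟨_, .app_res_neg hv hN hT hl, rfl⟩⟩

/-- Only arity `0` needs the stack condition: with no subtree to vouch for the stack, `IsStack`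
supplies exactly the side condition of the rule for constants. -/
theorem IGraph.wire_con {v a c m e} (hv : G.link v = .con a c m e) {U : List (Entry S G.V)}
    (hU : G.IsStack (G.box e) U) (ts : Fin (S.arity a c) → Alg S a)
    (hts : ∀ j, G.wire e U ⟨a, ts j⟩
      (.argAt (.base a m) (S.arity a c) j .hole (.base a m))) :
    G.wire e U ⟨a, .mk c ts⟩ (.arrows (.base a m) (S.arity a c) .hole) := by
  rcases Nat.eq_zero_or_pos (S.arity a c) with h0 | hpos
  · simp only [h0, TyCtx.arrows]
    cases hb : G.box e with
    | none =>
      rw [hb] at hU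
      obtain rfl : U = [] := hU
      exact ⟨_, .con_zero hv h0 hb, rfl⟩
    | some w =>
      rw [hb] at hU
      obtain ⟨e₀, b, u, s, U', hρ, rfl, T, hT, hl⟩ := hU
      exact ⟨_, .con_zero_box hv h0 hb hρ hT hl, rfl⟩
  · choose Ts hT hl using hts
    exact ⟨_, .con_succ hv hpos hT hl, rfl⟩

section

variable {v : G.V} {a : Fin S.n} {e₀ g : G.E} {es : Fin (S.k a) → G.E} {A C : Ty S}
  {U : List (Entry S G.V)}

theorem IGraph.le_wire_of_cond (hv : G.link v = .cond a e₀ es g) (hA : G.ty e₀ = A)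
    (hC : G.ty g = C) {i ts} (h : G.wire e₀ U ⟨a, .mk i ts⟩ .hole) :
    Wire.Le C ((G.wire (es i) U).comap (.arrows A (S.arity a i))) (G.wire g U) := by
  subst hA hC
  obtain ⟨_, hT, hl⟩ := h
  exact ⟨fun hP ⟨_, hT', hl'⟩ => ⟨_, .cond_res_pos hv hT hl hP hT' hl', rfl⟩,
    fun hN ⟨_, hT', hl'⟩ => ⟨_, .cond_res_neg hv hT hl hN hT' hl', rfl⟩⟩

theorem IGraph.wire_cond_arg (hv : G.link v = .cond a e₀ es g) (hA : G.ty e₀ = A)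
    (hC : G.ty g = C) {i ts} (h : G.wire e₀ U ⟨a, .mk i ts⟩ .hole) (j : Fin (S.arity a i)) :
    G.wire (es i) U ⟨a, ts j⟩ (.argAt A (S.arity a i) j .hole C) := by
  subst hA hC
  obtain ⟨_, hT, hl⟩ := h
  exact ⟨_, .cond_arg j hv hT hl, rfl⟩

theorem IGraph.wire_rec_arg (hv : G.link v = .recC a e₀ es g) (hA : G.ty e₀ = A)
    (hC : G.ty g = C) {u : NCtx S a} {i ts} (h : G.wire e₀ U ⟨a, u.fill (.mk i ts)⟩ .hole)
    (j : Fin (S.arity a i)) :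
    G.wire (es i) (⟨a, u, .mk i ts, v⟩ :: U) ⟨a, ts j⟩
      (.argAt A (S.arity a i) j .hole (C.arrows (S.arity a i) C)) := by
  subst hA hC
  obtain ⟨_, hT, hl⟩ := h
  exact ⟨_, .rec_arg j hv hT hl, rfl⟩

theorem IGraph.le_wire_of_rec_copy (hv : G.link v = .recC a e₀ es g) (hA : G.ty e₀ = A)
    (hC : G.ty g = C) {u : NCtx S a} {i ts} (h : G.wire e₀ U ⟨a, u.fill (.mk i ts)⟩ .hole)
    (k : Fin (S.arity a i)) {j ss} (hk : ts k = .mk j ss) :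
    Wire.Le C
      ((G.wire (es j) (⟨a, u.comp (NCtx.around i ts k), .mk j ss, v⟩ :: U)).comap fun L =>
        .arrows A (S.arity a j) (.arrows C (S.arity a j) L))
      ((G.wire (es i) (⟨a, u, .mk i ts, v⟩ :: U)).comap fun L =>
        .arrows A (S.arity a i) (.argAt C (S.arity a i) k L C)) := by
  subst hA hC
  obtain ⟨_, hT, hl⟩ := h
  rw [← hk]
  exact ⟨fun hP ⟨_, hT', hl'⟩ => ⟨_, .rec_copy_pos k hv hT hl hk hP hT' hl', rfl⟩,
    fun hN ⟨_, hT', hl'⟩ => ⟨_, .rec_copy_neg k hv hT hl hk hN hT' hl', rfl⟩⟩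

theorem IGraph.le_wire_of_rec_res (hv : G.link v = .recC a e₀ es g) (hA : G.ty e₀ = A)
    (hC : G.ty g = C) {i ts} (h : G.wire e₀ U ⟨a, .mk i ts⟩ .hole) :
    Wire.Le C
      ((G.wire (es i) (⟨a, .hole, .mk i ts, v⟩ :: U)).comap fun L =>
        .arrows A (S.arity a i) (.arrows C (S.arity a i) L)) (G.wire g U) := by
  subst hA hC
  obtain ⟨_, hT, hl⟩ := h
  exact ⟨fun hP ⟨_, hT', hl'⟩ => ⟨_, .rec_res_pos hv hT hl hP hT' hl', rfl⟩,
    fun hN ⟨_, hT', hl'⟩ => ⟨_, .rec_res_neg hv hT hl hN hT' hl', rfl⟩⟩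

end

/-- The flow of a derivation whose graph is embedded in `G`. -/
theorem Deriv.flow {Γ : Ctx S} {M : Tm S} {A : Ty S} (π : Deriv (baseTypes S) Γ M A)
    {b : Option G.V} (f : G.Emb π.graph b) {U : List (Entry S G.V)} (hU : G.IsStack b U)
    {Δ : FlowCtx S} (hΔ : Δ.Covers f U) :
    Flow G.Reaches Δ M A (G.wire (f.edge π.graph.concl) U) := by
  -- The ambient graph `G` is fixed; only the embedding of the current subgraph, its box-premise and
  -- its stack vary.
  induction π generalizing b U Δ with
  | ax x A =>
    obtain ⟨q, hq, hle⟩ := hΔ x A (by simp [Ctx.add])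
    exact .var hq hle
  | @weak Γ M B x A hx π ih =>
    refine ih (f.comp (IGraph.embWeak x A π.graph)) hU fun y B hy => ?_
    have hne : y ≠ x := by
      rintro rfl
      simp [hx] at hy
    obtain ⟨q, hq, hle⟩ := hΔ y B (by simp [Ctx.add, hne, hy])
    refine ⟨q, hq, ?_⟩
    simp only [Deriv.graph, IGraph.weakG, dif_neg hne] at hle
    exact hle
  | @contr Γ M N B x y z A hA hxy hx hy hz hN π ih =>
    subst hN
    have hlink := f.link none
    obtain ⟨q, hq, hle⟩ := hΔ z A (by simp [Ctx.add])
    -- The unmerged body gets precisely the wires of its premise edges; the merge is then an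
    -- instance of `Flow.rename`.
    let Δ' : FlowCtx S := fun w B p => ∃ hw : ((Γ.add x A).add y A) w = some B,
      p = G.wire (f.edge (some (π.graph.prem w (by simp [hw])))) U
    refine Flow.rename (Γ := Δ') (ih (f.comp (IGraph.embContr x y z A π.graph)) hU
      fun w B hw => ⟨_, ⟨hw, rfl⟩, .refl _ _⟩) ?_
    rintro w B p ⟨hw, rfl⟩
    by_cases hwxy : w = x ∨ w = y
    · have hB : B = A := by
        rcases hwxy with rfl | rfl <;> simp_all [Ctx.add]
      subst hB
      refine ⟨q, by simpa [mergeRen, hwxy] using hq, hle.trans ?_⟩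
      -- The rules for `X` only go from the shared edge to its two uses, which is a full forwarding
      -- at a base type.
      obtain ⟨a, m, rfl⟩ := hA
      refine Wire.le_base fun t ⟨T, hT, hl⟩ => ?_
      simp only [Deriv.graph, IGraph.contrG, dite_true] at hl
      rcases hwxy with rfl | rfl
      · exact ⟨_, .contr_left hlink hT hl, rfl⟩
      · exact ⟨_, .contr_right hlink hT hl, rfl⟩
    · obtain ⟨hwx, hwy⟩ := not_or.1 hwxy
      have hΓ : Γ w = some B := by simpa [Ctx.add, hwx, hwy] using hw
      have hwz : w ≠ z := by
        rintro rfl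
        simp [hz] at hΓ
      obtain ⟨q, hq, hle⟩ := hΔ w B (by simp [Ctx.add, hwz, hΓ])
      refine ⟨q, by simpa [mergeRen, hwxy] using hq, ?_⟩
      simp only [Deriv.graph, IGraph.contrG, dif_neg hwz] at hle
      exact hle
  | @lam Γ M A B π ih =>
    have hlink := f.link none
    have hA : G.ty (f.edge (some (π.graph.prem 0 rfl))) = A :=
      (f.ty _).trans (π.ty_prem rfl _)
    have hB : G.ty (f.edge (some π.graph.concl)) = B :=
      (f.ty _).trans π.ty_concl
    refine .lam (ih (f.comp (IGraph.embLam A B π.graph)) hU fun x C hx => ?_)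
      (IGraph.le_wire_of_lam_arg hlink U hA hB) (IGraph.le_wire_of_lam_res hlink U hA hB)
    cases x with
    | zero =>
      obtain rfl : A = C := by simpa [Ctx.bind] using hx
      exact ⟨_, ⟨rfl, rfl⟩, .refl _ _⟩
    | succ x => exact hΔ x C hx
  | @app Γ Δ' Θ M N A B h π ξ ihM ihN =>
    have hlink := f.link none
    have hA : G.ty (f.edge (some (.inr ξ.graph.concl))) = A :=
      (f.ty _).trans ξ.ty_concl
    have hB : G.ty (f.edge none) = B := f.ty none
    refine .app (ihM (f.comp (IGraph.embFun h B π.graph ξ.graph)) hU fun x C hx => ?_)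
      (ihN (f.comp (IGraph.embArg h B π.graph ξ.graph)) hU fun x C hx => ?_)
      IGraph.wire_reaches
      (IGraph.le_wire_of_app_arg hlink U hA hB) (IGraph.le_wire_of_app_res hlink U hA hB)
    · obtain ⟨q, hq, hle⟩ := hΔ x C (h.eq (i := false) hx)
      refine ⟨q, hq, ?_⟩
      simp only [Deriv.graph, IGraph.appG] at hle
      rw [joinPrem_eq h _ _ (i := false) (by simp [Ctx.pair, hx])] at hle
      exact hle
    · obtain ⟨q, hq, hle⟩ := hΔ x C (h.eq (i := true) hx)
      refine ⟨q, hq, ?_⟩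
      simp only [Deriv.graph, IGraph.appG] at hle
      rw [joinPrem_eq h _ _ (i := true) (by simp [Ctx.pair, hx])] at hle
      exact hle
  | con a c m hB =>
    have hlink := f.link ()
    have hbox : G.box (f.edge ()) = b := f.box ()
    rw [← hbox] at hU
    exact .con hB fun ts hts => IGraph.wire_con hlink hU ts hts
  | @cond a m Γs Δ' Θ L Ms C h πs ξ ihs ih =>
    have hlink := f.link none
    have h₀ : G.ty (f.edge (some (.inl ξ.graph.concl))) = .base a m :=
      (f.ty _).trans ξ.ty_concl
    have hC : G.ty (f.edge none) = C := f.ty none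
    refine .cond rfl (ih (f.comp (IGraph.embCondArg h C (fun i => (πs i).graph) ξ.graph)) hU
        fun x C hx => ?_) IGraph.wire_reaches
      (fun i => ihs i (f.comp (IGraph.embCondBranch h C (fun i => (πs i).graph) ξ.graph i)) hU
        fun x C hx => ?_)
      fun i ts hT => ⟨IGraph.le_wire_of_cond hlink h₀ hC hT, IGraph.wire_cond_arg hlink h₀ hC hT⟩
    · obtain ⟨q, hq, hle⟩ := hΔ x C (h.eq (i := none) hx)
      refine ⟨q, hq, ?_⟩
      simp only [Deriv.graph, IGraph.condG] at hle
      rw [joinPrem_eq h _ _ (i := none) (by simp [Ctx.family, hx])] at hle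
      exact hle
    · obtain ⟨q, hq, hle⟩ := hΔ x C (h.eq (i := some i) hx)
      refine ⟨q, hq, ?_⟩
      simp only [Deriv.graph, IGraph.condG] at hle
      rw [joinPrem_eq h _ _ (i := some i) (by simp [Ctx.family, hx])] at hle
      exact hle
  | @recur a m Γs Δ' Θ L Ms C h hD πs ξ ihs ih =>
    have hlink := f.link none
    have hρ := f.rho none
    have h₀ : G.ty (f.edge (some (.inl ξ.graph.concl))) = .base a m :=
      (f.ty _).trans ξ.ty_concl
    have hC : G.ty (f.edge none) = C := f.ty none
    -- The copy for `(u, s)` lives on the conclusion edge of the branch chosen by the head of `s`,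
    -- with the entry `(u, s)` pushed on the stack. That `u[s]` reaches the argument edge makes the
    -- new stack legal.
    refine .recur (q := fun u s => match s with
      | .mk i ts => G.wire (f.edge (some (.inr (.inl ⟨i, (πs i).graph.concl⟩))))
          (⟨a, u, .mk i ts, f.vert none⟩ :: U)) rfl
      (ih (f.comp (IGraph.embRecArg h C (fun i => (πs i).graph) ξ.graph)) hU
        fun x C hx => ?_) IGraph.wire_reaches (fun u s => ?_)
      (fun u i ts hT => ihs i
        (f.comp (IGraph.embRecBranch h C (fun i => (πs i).graph) ξ.graph i))
        ⟨_, a, u, .mk i ts, U, hρ, rfl, hT⟩ fun x C hx => ?_)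
      (fun u i ts hT => IGraph.wire_rec_arg hlink h₀ hC hT)
      (fun u i ts hT k j ss hk => IGraph.le_wire_of_rec_copy hlink h₀ hC hT k hk)
      (fun i ts hT => IGraph.le_wire_of_rec_res hlink h₀ hC hT)
    · obtain ⟨q, hq, hle⟩ := hΔ x C (h.eq (i := none) hx)
      refine ⟨q, hq, ?_⟩
      simp only [Deriv.graph, IGraph.recG] at hle
      rw [joinPrem_eq h _ _ (i := none) (by simp [Ctx.family, hx])] at hle
      exact hle
    · cases s
      exact IGraph.wire_reaches
    · obtain ⟨q, hq, hle⟩ := hΔ x C (h.eq (i := some i) hx)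
      refine ⟨q, hq, ?_⟩
      simp only [Deriv.graph, IGraph.recG] at hle
      rw [joinPrem_eq h _ _ (i := some i) (by simp [Ctx.family, hx])] at hle
      refine hle.trans ?_
      -- As for contraction, `P^R` only forwards into the box; the restriction on the contexts of
      -- branches makes this enough.
      obtain ⟨a', m', rfl⟩ := hD i x C hx
      refine Wire.le_base fun t ⟨T', hT', hl'⟩ => ?_
      have hx' : (Γs i x).isSome := by simp [hx]
      have hbox := (f.comp (IGraph.embRecBranch h C (fun i => (πs i).graph) ξ.graph i)).box
        ((πs i).graph.prem x hx')
      rw [(πs i).box_prem hx hx'] at hbox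
      obtain ⟨T, hT, hl⟩ := hT
      exact ⟨_, .recP (f.link (some (.inr (.inr ⟨i, x, hx'⟩)))) hbox hρ hT hl hT' hl', rfl⟩

end Wires

end ACS

theorem mainTheorem1 (S : ACS.AlgFamily) {Γ : ACS.Ctx S} {M N : ACS.Tm S} {A : ACS.Ty S}
    (π : ACS.Deriv (ACS.baseTypes S) Γ M A) (hMN : ACS.Steps M N)
    {a : Fin S.n} (t : ACS.Alg S a) (ht : ACS.RedexArg N t) :
    ∃ T : ACS.Tree π.graph, ACS.InT π.graph T ∧ T.term = ⟨a, t⟩ := by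
  -- Free variables get the wires of the premise edges; outside all boxes the only legal stack is
  -- empty.
  let Δ : ACS.FlowCtx S := fun x B p => ∃ hx : Γ x = some B,
    p = π.graph.wire (π.graph.prem x (by simp [hx])) []
  have h := π.flow (ACS.IGraph.Emb.id π.graph) (U := []) (Δ := Δ) rfl
    fun x B hx => ⟨_, ⟨hx, rfl⟩, .refl _ _⟩
  exact (h.steps hMN).of_redexArg ht
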